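/- All Hilbert spaces are finite-dimensional and $\log=\log_2$. Let $\rho^{ABC}$ be a density operator, $\Psi_\rho^{RABC}$ a purification of it, and let $\bar M_A=\{\bar\Lambda^A_s\}_{s\in\mathcal S}$, $\bar M_B=\{\bar\Lambda^B_t\}_{t\in\mathcal T}$ be POVMs on $\mathcal H_A,\mathcal H_B$ with finite outcome sets. Let $f_S:\mathcal S\to\mathcal U$ and $f_T:\mathcal T\to\mathcal V$ be maps into finite sets (for example into a prime field $\mathbb F_p$), and put $U=f_S(S)$, $V=f_T(T)$, $\Lambda^A_u=\sum_{s:f_S(s)=u}\bar\Lambda^A_s$, $\Lambda^B_v=\sum_{t:f_T(t)=v}\bar\Lambda^B_t$. Let $$\sigma_1^{RBCS}=\sum_s \mathrm{Tr}_A\{(\bar\Lambda^A_s\otimes I)\Psi_\rho\}\otimes|s\rangle\langle s|,\qquad \sigma_2^{RACT}=\sum_t \mathrm{Tr}_B\{(\bar\Lambda^B_t\otimes I)\Psi_\rho\}\otimes|t\rangle\langle t| .$$ *Approximating operators.* Let $\lambda^A_u=\mathrm{Tr}(\Lambda^A_u\rho^A)$, $\hat\rho^A_u=\frac1{\lambda^A_u}\sqrt{\rho^A}\Lambda^A_u\sqrt{\rho^A}$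 (irrelevant, say $0$, if $\lambda^A_u=0$), and write $\lambda^A_{u^n}=\prod_i\lambda^A_{u_i}$, $\hat\rho^A_{u^n}=\bigotimes_i\hat\rho^A_{u_i}$. For $\delta>0$ let $\mathcal T^{(n)}_\delta(U)$ be the set of strongly typical sequences $u^n$: $|\frac1nN(u|u^n)-\lambda^A_u|\le\delta$ for all $u$, and $N(u|u^n)=0$ if $\lambda^A_u=0$, where $N(u|u^n)$ is the number of occurrences of $u$ in $u^n$. Fix a spectral decomposition $\rho^A=\sum_x p(x)|x\rangle\langle x|$ and, for each $u$, one $\hat\rho^A_u=\sum_y p(y|u)|y_u\rangle\langle y_u|$. Let $\Pi_{\rho^A}$ be the $\delta$-typical projector, onto the span of those $|x_1\rangle\otimes\cdots\otimes|x_n\rangle$ with $2^{-n(S(\rho^A)+\delta)}\le\prod_ip(x_i)\le2^{-n(S(\rho^A)-\delta)}$, and let $\Pi^A_{u^n}$ be the strong conditionally typical projector, onto the span of those $\bigotimes_i|(y_i)_{u_i}\rangle$ such that for every $u$ the subsequence of $y^n$ at the positions where $u^n$ equals $u$ is strongly $\delta$-typical for $p(\cdot|u)$. Put $\tilde\rho^A_{u^n}=\Pi_{\rho^A}\Pi^A_{u^n}\hat\rho^A_{u^n}\Pi^A_{u^n}\Pi_{\rho^A}$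 for $u^n\in\mathcal T^{(n)}_\delta(U)$ and $\tilde\rho^A_{u^n}=0$ otherwise. Let $\varepsilon=1-\sum_{u^n\in\mathcal T^{(n)}_\delta(U)}\lambda^A_{u^n}$. Given $\tilde R_1$, draw $M_1=\lfloor2^{n\tilde R_1}\rfloor$ independent codewords $U^n(1),\dots,U^n(M_1)$, each equal to $u^n$ with probability $\lambda^A_{u^n}/(1-\varepsilon)$ if $u^n\in\mathcal T^{(n)}_\delta(U)$ and with probability $0$ otherwise. For $\eta\in(0,1)$ set $$A_{u^n}=\gamma_{u^n}\,\sqrt{\rho_A}^{\,-1}\,\tilde\rho^A_{u^n}\,\sqrt{\rho_A}^{\,-1},\qquad \gamma_{u^n}=\frac{1-\varepsilon}{1+\eta}\cdot\frac{|\{l:U^n(l)=u^n\}|}{M_1},$$ where $\sqrt{\rho_A}^{\,-1}$ is the inverse on the support of the square root of $(\rho^A)^{\otimes n}$. Define $\mathcal T^{(n)}_\delta(V)$, $\varepsilon'$, the codewords $V^n(1),\dots,V^n(M_2)$ with $M_2=\lfloor2^{n\tilde R_2}\rfloor$, and the operators $B_{v^n}$ in the same way from $\rho^B$, $\{\Lambda^B_v\}$,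 $\tilde R_2$ and the same $\delta,\eta$; all the codewords of both codebooks are mutually independent. Let sP-1 and sP-2 be the events that $\{A_{u^n}:u^n\in\mathcal T^{(n)}_\delta(U)\}$, respectively $\{B_{v^n}:v^n\in\mathcal T^{(n)}_\delta(V)\}$, is a sub-POVM, i.e. consists of positive semidefinite operators whose sum is at most $I$. **Proposition.** Suppose $\tilde R_1>I(U;RBC)_{\sigma_1}$ and $\tilde R_2>I(V;RAC)_{\sigma_2}$. Then for every $\epsilon\in(0,1)$ and every $\eta\in(0,1)$ there is $\delta_0\in(0,1)$ such that for every $\delta\in(0,\delta_0)$ there is $n_0$ such that for all $n\ge n_0$ $$\mathbb E\big[\mathbb 1_{\{\text{sP-1}\}}\,\mathbb 1_{\{\text{sP-2}\}}\big]>1-\epsilon .$$ -/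

import Mathlib

namespace PurityDistillation

open scoped Kronecker ComplexOrder
open Matrix

/-! ### States, measurements, entropies (all matrices are over finite index types) -/

section Basic

variable {a e s u : Type*} [Fintype a] [DecidableEq a] [Fintype e] [DecidableEq e]
  [Fintype s] [DecidableEq s] [Fintype u] [DecidableEq u]

/-- A density operator. -/
def IsDensity (ρ : Matrix a a ℂ) : Prop :=
  ρ.PosSemidef ∧ ρ.trace = 1

/-- A POVM with finite outcome set `s`. -/
def IsPOVM (Λ : s → Matrix a a ℂ) : Prop :=
  (∀ i, (Λ i).PosSemidef) ∧ ∑ i, Λ i = 1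

/-- A sub-POVM: positive semidefinite operators whose sum is at most the identity. -/
def IsSubPOVM (Λ : s → Matrix a a ℂ) : Prop :=
  (∀ i, (Λ i).PosSemidef) ∧ (1 - ∑ i, Λ i).PosSemidef

/-- The POVM of the outcome `f S`, where `S` is the outcome of the POVM `Λ`. -/
def coarsePOVM (f : s → u) (Λ : s → Matrix a a ℂ) (j : u) : Matrix a a ℂ :=
  ∑ i with f i = j, Λ i

/-- Partial trace over the first tensor factor. -/
def traceFst (X : Matrix (a × e) (a × e) ℂ) : Matrix e e ℂ :=
  Matrix.of fun k k' => ∑ x, X (x, k) (x, k')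

/-- Partial trace over the second tensor factor. -/
def traceSnd (X : Matrix (a × e) (a × e) ℂ) : Matrix a a ℂ :=
  Matrix.of fun x x' => ∑ k, X (x, k) (x', k)

/-- The rank-one operator `|ψ⟩⟨ψ|`. -/
def ketbra (ψ : a → ℂ) : Matrix a a ℂ :=
  Matrix.vecMulVec ψ (star ψ)

/-- Square root of a positive semidefinite matrix (functional calculus). -/
noncomputable def msqrt (ρ : Matrix a a ℂ) : Matrix a a ℂ :=
  cfc (fun x : ℝ => Real.sqrt x) ρ

/-- Inverse square root of a positive semidefinite matrix, taken on its support
(eigenvalue `0` is sent to `0`). -/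
noncomputable def minvSqrt (ρ : Matrix a a ℂ) : Matrix a a ℂ :=
  cfc (fun x : ℝ => (Real.sqrt x)⁻¹) ρ

/-- Von Neumann entropy `- Tr (ρ log₂ ρ)`, in bits. -/
noncomputable def vnEntropy (ρ : Matrix a a ℂ) : ℝ :=
  (cfc Real.negMulLog ρ).trace.re / Real.log 2

/-- Shannon entropy in bits. -/
noncomputable def shannonEntropy (p : a → ℝ) : ℝ :=
  (∑ y, Real.negMulLog (p y)) / Real.log 2

/-- Quantum mutual information of a bipartite state, in bits. -/
noncomputable def mutualInfo (σ : Matrix (e × u) (e × u) ℂ) : ℝ :=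
  vnEntropy (traceSnd σ) + vnEntropy (traceFst σ) - vnEntropy σ

/-- Measuring the first factor of `Ψ` with `Λ` and keeping the outcome register:
`∑ᵢ Tr_a {(Λᵢ ⊗ I) Ψ} ⊗ |i⟩⟨i|`, on the remaining system `e` and the register `s`. -/
def postMeasurement (Λ : s → Matrix a a ℂ) (Ψ : Matrix (a × e) (a × e) ℂ) :
    Matrix (e × s) (e × s) ℂ :=
  Matrix.blockDiagonal fun i => traceFst ((Λ i ⊗ₖ (1 : Matrix e e ℂ)) * Ψ)

/-- Relabelling of a classical register through `f`: the channel
`σ ↦ ∑ᵢ (I ⊗ |f i⟩⟨i|) σ (I ⊗ |i⟩⟨f i|)`. -/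
def relabel (f : s → u) (σ : Matrix (e × s) (e × s) ℂ) : Matrix (e × u) (e × u) ℂ :=
  Matrix.of fun x y => if x.2 = y.2 then ∑ i with f i = x.2, σ (x.1, i) (y.1, i) else 0

/-- `W` is a unitary whose columns are eigenvectors of `ρ`, with eigenvalues `p`. -/
def IsSpectralDecomposition (ρ W : Matrix a a ℂ) (p : a → ℝ) : Prop :=
  W ∈ Matrix.unitaryGroup a ℂ ∧ ρ = W * Matrix.diagonal (fun y => (p y : ℂ)) * Wᴴ

/-- Outcome probability `Tr (Λᵢ ρ)`. -/
def outcomeProb (ρ : Matrix a a ℂ) (Λ : s → Matrix a a ℂ) (i : s) : ℝ :=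
  (Λ i * ρ).trace.re

/-- States of the canonical ensemble, `√ρ Λᵢ √ρ / Tr (Λᵢ ρ)` (zero if the probability is zero). -/
noncomputable def canonicalState (ρ : Matrix a a ℂ) (Λ : s → Matrix a a ℂ) (i : s) :
    Matrix a a ℂ :=
  ((outcomeProb ρ Λ i : ℂ))⁻¹ • (msqrt ρ * Λ i * msqrt ρ)

end Basic

/-! ### Reduced states of a tripartite state and of its purification -/

section Tripartite

variable {a b c r : Type*} [Fintype a] [Fintype b] [Fintype c] [Fintype r]

/-- Reduced state on `A`. -/
def marginalA (ρ : Matrix (a × b × c) (a × b × c) ℂ) : Matrix a a ℂ :=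
  traceSnd ρ

/-- Reduced state on `B`. -/
def marginalB (ρ : Matrix (a × b × c) (a × b × c) ℂ) : Matrix b b ℂ :=
  traceSnd (traceFst ρ)

/-- `ψ`, a vector of `R ⊗ A ⊗ B ⊗ C`, is a purification of `ρ`. -/
def IsPurification (ψ : r × a × b × c → ℂ) (ρ : Matrix (a × b × c) (a × b × c) ℂ) : Prop :=
  traceFst (ketbra ψ) = ρ

/-- The pure state `|ψ⟩⟨ψ|` with the factors ordered as `A, (R, B, C)`. -/
def pureA (ψ : r × a × b × c → ℂ) : Matrix (a × (r × b × c)) (a × (r × b × c)) ℂ :=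
  ketbra fun x => ψ (x.2.1, x.1, x.2.2.1, x.2.2.2)

/-- The pure state `|ψ⟩⟨ψ|` with the factors ordered as `B, (R, A, C)`. -/
def pureB (ψ : r × a × b × c → ℂ) : Matrix (b × (r × a × c)) (b × (r × a × c)) ℂ :=
  ketbra fun x => ψ (x.2.1, x.2.2.1, x.1, x.2.2.2)

end Tripartite

/-! ### Typical sets and typical projectors -/

section Typicality

variable {a u : Type*} [Fintype a] [DecidableEq a] [Fintype u] [DecidableEq u]

/-- Product probability of a sequence. -/
def seqProb (q : u → ℝ) {n : ℕ} (w : Fin n → u) : ℝ :=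
  ∏ i, q (w i)

/-- Number of occurrences of the letter `j` in `w`. -/
def countLetter {n : ℕ} (w : Fin n → u) (j : u) : ℕ :=
  Fintype.card {i // w i = j}

/-- Number of joint occurrences of the letters `j`, `y` in `(w, x)`. -/
def countPair {n : ℕ} (w : Fin n → u) (x : Fin n → a) (j : u) (y : a) : ℕ :=
  Fintype.card {i // w i = j ∧ x i = y}

open Classical in
/-- Strongly typical sequences: every empirical frequency is within `δ` of `q`, and letters of
probability zero do not occur. -/
noncomputable def strongTypical (q : u → ℝ) (δ : ℝ) (n : ℕ) : Finset (Fin n → u) :=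
  Finset.univ.filter fun w =>
    ∀ j, |(countLetter w j : ℝ) - n * q j| ≤ n * δ ∧ (q j = 0 → countLetter w j = 0)

open Classical in
/-- Weakly (entropy-)typical sequences: `2 ^ (-n (H + δ)) ≤ p(xⁿ) ≤ 2 ^ (-n (H - δ))`, which for
`n > 0` says that the sample entropy `-(1/n) log₂ p(xⁿ)` is within `δ` of `H`. -/
noncomputable def weakTypical (p : a → ℝ) (δ : ℝ) (n : ℕ) : Finset (Fin n → a) :=
  Finset.univ.filter fun x =>
    (2 : ℝ) ^ (-(n : ℝ) * (shannonEntropy p + δ)) ≤ seqProb p x ∧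
      seqProb p x ≤ (2 : ℝ) ^ (-(n : ℝ) * (shannonEntropy p - δ))

open Classical in
/-- Strongly conditionally typical sequences given `w`: for each letter `j`, the subsequence of
`x` at the positions where `w` equals `j` is strongly `δ`-typical for `p j`. -/
noncomputable def condTypical (p : u → a → ℝ) (δ : ℝ) {n : ℕ} (w : Fin n → u) :
    Finset (Fin n → a) :=
  Finset.univ.filter fun x =>
    ∀ j y, |(countPair w x j y : ℝ) - countLetter w j * p j y| ≤ countLetter w j * δ ∧
      (p j y = 0 → countPair w x j y = 0)

/-- Tensor product `X₁ ⊗ ⋯ ⊗ Xₙ` of matrices. -/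
def tensorMat {n : ℕ} (X : Fin n → Matrix a a ℂ) : Matrix (Fin n → a) (Fin n → a) ℂ :=
  Matrix.of fun x y => ∏ i, X i (x i) (y i)

/-- Projector onto the span of the product vectors `⊗ᵢ (column x i of W i)`, `x ∈ T`. -/
def seqProjector {n : ℕ} (W : Fin n → Matrix a a ℂ) (T : Finset (Fin n → a)) :
    Matrix (Fin n → a) (Fin n → a) ℂ :=
  ∑ x ∈ T, ketbra fun z => ∏ i, W i (z i) (x i)

/-- Typical projector of the state with eigenvectors the columns of `W`, eigenvalues `p`. -/
noncomputable def typicalProjector (W : Matrix a a ℂ) (p : a → ℝ) (δ : ℝ) (n : ℕ) :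
    Matrix (Fin n → a) (Fin n → a) ℂ :=
  seqProjector (fun _ => W) (weakTypical p δ n)

/-- Strong conditionally typical projector of an ensemble whose `j`-th state has eigenvectors
the columns of `W j` and eigenvalues `p j`. -/
noncomputable def condTypicalProjector (W : u → Matrix a a ℂ) (p : u → a → ℝ) (δ : ℝ) {n : ℕ}
    (w : Fin n → u) : Matrix (Fin n → a) (Fin n → a) ℂ :=
  seqProjector (fun i => W (w i)) (condTypical p δ w)

end Typicality

/-! ### The random codebook and the approximating operators of one party

`ρ` is the state of the party, `Λ` its POVM, `(W₀, p₀)` a spectral decomposition of `ρ`, and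
`(W j, p j)` one of the `j`-th state of the canonical ensemble. -/

section Code

variable {a u : Type*} [Fintype a] [DecidableEq a] [Fintype u] [DecidableEq u]

/-- Probability of the strongly typical set. -/
noncomputable def typicalMass (q : u → ℝ) (δ : ℝ) (n : ℕ) : ℝ :=
  ∑ w ∈ strongTypical q δ n, seqProb q w

open Classical in
/-- Pruned distribution: the product distribution conditioned on the strongly typical set. -/
noncomputable def prunedProb (q : u → ℝ) (δ : ℝ) (n : ℕ) (w : Fin n → u) : ℝ :=
  if w ∈ strongTypical q δ n then seqProb q w / typicalMass q δ n else 0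

open Classical in
/-- The cut-off state `Π_ρ Π_w ρ̂_w Π_w Π_ρ` for typical `w`, and `0` otherwise. -/
noncomputable def cutoffState (ρ : Matrix a a ℂ) (Λ : u → Matrix a a ℂ)
    (W₀ : Matrix a a ℂ) (p₀ : a → ℝ) (W : u → Matrix a a ℂ) (p : u → a → ℝ)
    (δ : ℝ) {n : ℕ} (w : Fin n → u) : Matrix (Fin n → a) (Fin n → a) ℂ :=
  if w ∈ strongTypical (outcomeProb ρ Λ) δ n then
    typicalProjector W₀ p₀ δ n * condTypicalProjector W p δ w *
      tensorMat (fun i => canonicalState ρ Λ (w i)) *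
      condTypicalProjector W p δ w * typicalProjector W₀ p₀ δ n
  else 0

/-- Number of codewords, `2 ^ (n R)` rounded down. -/
noncomputable def codebookSize (R : ℝ) (n : ℕ) : ℕ :=
  ⌊(2 : ℝ) ^ ((n : ℝ) * R)⌋₊

/-- The weight `(1 - ε) / (1 + η) · M⁻¹ · |{l : C l = w}|`, where `1 - ε` is the probability of
the typical set and `M` the number of codewords of the codebook `C`. -/
noncomputable def codeWeight (q : u → ℝ) (δ η : ℝ) {n M : ℕ} (C : Fin M → Fin n → u)
    (w : Fin n → u) : ℝ :=
  typicalMass q δ n / (1 + η) * (M : ℝ)⁻¹ * (Fintype.card {l // C l = w} : ℝ)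

/-- The operator `weight_w · √ρ⁻¹ ρ̃_w √ρ⁻¹`, with `ρ` taken `n`-fold. -/
noncomputable def codeOperator (ρ : Matrix a a ℂ) (Λ : u → Matrix a a ℂ)
    (W₀ : Matrix a a ℂ) (p₀ : a → ℝ) (W : u → Matrix a a ℂ) (p : u → a → ℝ)
    (δ η : ℝ) {n M : ℕ} (C : Fin M → Fin n → u) (w : Fin n → u) :
    Matrix (Fin n → a) (Fin n → a) ℂ :=
  (codeWeight (outcomeProb ρ Λ) δ η C w : ℂ) •
    (minvSqrt (tensorMat fun _ : Fin n => ρ) * cutoffState ρ Λ W₀ p₀ W p δ w *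
      minvSqrt (tensorMat fun _ : Fin n => ρ))

open Classical in
/-- Indicator of the event that the operators indexed by the typical sequences form a
sub-POVM. -/
noncomputable def subPOVMIndicator (ρ : Matrix a a ℂ) (Λ : u → Matrix a a ℂ)
    (W₀ : Matrix a a ℂ) (p₀ : a → ℝ) (W : u → Matrix a a ℂ) (p : u → a → ℝ)
    (δ η : ℝ) {n M : ℕ} (C : Fin M → Fin n → u) : ℝ :=
  if IsSubPOVM (fun w : {w // w ∈ strongTypical (outcomeProb ρ Λ) δ n} =>
    codeOperator ρ Λ W₀ p₀ W p δ η C w.1) then 1 else 0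

/-- Expectation of `f (C₁, C₂)` for random codebooks whose codewords are all mutually independent,
those of `C₁` having law `P` and those of `C₂` law `Q`. -/
def codebookExpectation {α β : Type*} [Fintype α] [Fintype β] (P : α → ℝ) (Q : β → ℝ)
    {M₁ M₂ : ℕ} (f : (Fin M₁ → α) → (Fin M₂ → β) → ℝ) : ℝ :=
  ∑ C₁ : Fin M₁ → α, ∑ C₂ : Fin M₂ → β, (∏ l, P (C₁ l)) * (∏ k, Q (C₂ k)) * f C₁ C₂

end Code

end PurityDistillation

open PurityDistillation

/-! For one party, the sum of the code operators is `((1 + η) M)⁻¹` times a sum of `M` independent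
copies of the positive random matrix `whitenedState`, so the sub-POVM event is an upper-tail event
for an i.i.d. matrix sum. Two bounds control it. (1) The mean is at most `1`: dropping the
conditional cutoff and the restriction to typical sequences only increases the average, which then
becomes the tensor power of `ρ` conjugated by `whitening`, a projector. (2) Each copy is at most
`K`, where `K` is about `2 ^ (n χ)` and `χ` is the Holevo quantity of the canonical ensemble.
Conditional typicality caps the eigenvalues of the cutoff state at about `2 ^ (-n ∑ q H(p))`, and
inverting `ρ` on its weakly typical subspace costs about `2 ^ (n H(p₀))`.

The bound `matrix_chernoff` then gives failure probability at most `d ^ n * exp (-η² M / (4 K))`.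
For `R > χ` and small `δ` the ratio `M / K` grows exponentially, so this beats the full dimension `d
^ n`. Only the upper tail matters, hence no lower bound on the mean is needed, and of the typical
mass only positivity.

The rate hypothesis becomes `χ < R` through `mutualInfo_eq`: `Y Yᴴ` and `Yᴴ Y` share their nonzero
spectrum, so entropies of the purifying systems are entropies on the measured side. Independence of
the codebooks turns the joint expectation into a product of the two one-party probabilities. -/

namespace PurityDistillation

open scoped Kronecker ComplexOrder MatrixOrder
open Matrix

set_option linter.unusedSectionVars false

/-! ### Functional calculus and traces through explicit spectral decompositions. -/

section Spectral

variable {m n : Type*} [Fintype m] [DecidableEq m] [Fintype n] [DecidableEq n]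

/-- The diagonal matrix of a real vector. -/
abbrev rdiag (p : n → ℝ) : Matrix n n ℂ := diagonal fun y => (p y : ℂ)

lemma IsSpectralDecomposition.eq {A W : Matrix n n ℂ} {p : n → ℝ}
    (h : IsSpectralDecomposition A W p) : A = W * rdiag p * Wᴴ := h.2

lemma IsSpectralDecomposition.conj_mul {A W : Matrix n n ℂ} {p : n → ℝ}
    (h : IsSpectralDecomposition A W p) : Wᴴ * W = 1 :=
  (mem_unitaryGroup_iff').1 h.1

lemma IsSpectralDecomposition.mul_conj {A W : Matrix n n ℂ} {p : n → ℝ}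
    (h : IsSpectralDecomposition A W p) : W * Wᴴ = 1 :=
  (mem_unitaryGroup_iff).1 h.1

lemma conj_rdiag_isHermitian (W : Matrix m n ℂ) (p : n → ℝ) :
    (W * rdiag p * Wᴴ).IsHermitian := by
  apply isHermitian_mul_mul_conjTranspose
  rw [IsHermitian, diagonal_conjTranspose]
  congr 1
  ext; simp

lemma conj_rdiag_posSemidef (W : Matrix m n ℂ) {p : n → ℝ} (hp : ∀ i, 0 ≤ p i) :
    (W * rdiag p * Wᴴ).PosSemidef :=
  (PosSemidef.diagonal fun i => by simpa using hp i).mul_mul_conjTranspose_same W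

lemma IsSpectralDecomposition.isHermitian {A W : Matrix n n ℂ} {p : n → ℝ}
    (h : IsSpectralDecomposition A W p) : A.IsHermitian :=
  h.eq ▸ conj_rdiag_isHermitian W p

lemma rdiag_mul (p q : n → ℝ) : rdiag p * rdiag q = rdiag fun i => p i * q i := by
  simp [rdiag, diagonal_mul_diagonal]

lemma exists_spectralDecomposition {A : Matrix n n ℂ} (hA : A.IsHermitian) :
    ∃ W p, IsSpectralDecomposition A W p := by
  refine ⟨hA.eigenvectorUnitary, hA.eigenvalues, hA.eigenvectorUnitary.2, ?_⟩
  conv_lhs => rw [hA.spectral_theorem]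
  rfl

/-- `Uᴴ * W` intertwines the two diagonals, so its `(i, j)` entry vanishes unless `p i = q j`; hence
it also intertwines their images under `f`. This makes `cfc` computable from any given
decomposition, not only from the chosen eigenbasis. -/
lemma mul_rdiag_eq_of_conj_eq {U W : Matrix n n ℂ} {p q : n → ℝ} (hU : Uᴴ * U = 1)
    (hU' : U * Uᴴ = 1) (hW : Wᴴ * W = 1) (hW' : W * Wᴴ = 1)
    (h : U * rdiag p * Uᴴ = W * rdiag q * Wᴴ) (f : ℝ → ℝ) :
    U * rdiag (f ∘ p) * Uᴴ = W * rdiag (f ∘ q) * Wᴴ := by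
  have key : rdiag p * (Uᴴ * W) = (Uᴴ * W) * rdiag q := by
    calc rdiag p * (Uᴴ * W) = (Uᴴ * U) * rdiag p * Uᴴ * W := by
          rw [hU, Matrix.one_mul, Matrix.mul_assoc]
      _ = Uᴴ * (U * rdiag p * Uᴴ) * W := by simp only [Matrix.mul_assoc]
      _ = (Uᴴ * W) * rdiag q * (Wᴴ * W) := by rw [h]; simp only [Matrix.mul_assoc]
      _ = _ := by rw [hW, Matrix.mul_one]
  have key2 : rdiag (f ∘ p) * (Uᴴ * W) = (Uᴴ * W) * rdiag (f ∘ q) := by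
    ext i j
    have := congr_fun (congr_fun key i) j
    simp only [rdiag, diagonal_mul, mul_diagonal] at this ⊢
    by_cases h0 : (Uᴴ * W) i j = 0
    · simp [h0]
    · rw [mul_comm] at this
      have := mul_left_cancel₀ h0 this
      have : p i = q j := by exact_mod_cast this
      simp [this, mul_comm]
  calc U * rdiag (f ∘ p) * Uᴴ = U * (rdiag (f ∘ p) * (Uᴴ * W)) * Wᴴ := by
        simp only [Matrix.mul_assoc, hW', Matrix.mul_one]
    _ = (U * Uᴴ) * W * rdiag (f ∘ q) * Wᴴ := by rw [key2]; simp only [Matrix.mul_assoc]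
    _ = _ := by rw [hU', Matrix.one_mul]

lemma IsSpectralDecomposition.cfc_eq {A W : Matrix n n ℂ} {p : n → ℝ}
    (h : IsSpectralDecomposition A W p) (f : ℝ → ℝ) : cfc f A = W * rdiag (f ∘ p) * Wᴴ := by
  have hA := h.isHermitian
  rw [hA.cfc_eq f]
  exact mul_rdiag_eq_of_conj_eq (mem_unitaryGroup_iff'.1 hA.eigenvectorUnitary.2)
    (mem_unitaryGroup_iff.1 hA.eigenvectorUnitary.2) h.conj_mul h.mul_conj
    (hA.spectral_theorem.symm.trans h.2) f

lemma IsSpectralDecomposition.trace_cfc {A W : Matrix n n ℂ} {p : n → ℝ}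
    (h : IsSpectralDecomposition A W p) (f : ℝ → ℝ) :
    (cfc f A).trace = ((∑ i, f (p i) : ℝ) : ℂ) := by
  rw [h.cfc_eq, trace_mul_comm, ← Matrix.mul_assoc, h.conj_mul, Matrix.one_mul]
  simp [trace, rdiag]

lemma IsSpectralDecomposition.trace_eq {A W : Matrix n n ℂ} {p : n → ℝ}
    (h : IsSpectralDecomposition A W p) : A.trace = ((∑ i, p i : ℝ) : ℂ) := by
  rw [h.eq, trace_mul_comm, ← Matrix.mul_assoc, h.conj_mul, Matrix.one_mul]
  simp [trace, rdiag]

lemma IsSpectralDecomposition.exp_eq {A W : Matrix n n ℂ} {p : n → ℝ}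
    (h : IsSpectralDecomposition A W p) :
    NormedSpace.exp A = W * rdiag (fun i => Real.exp (p i)) * Wᴴ := by
  have hW : W⁻¹ = Wᴴ := inv_eq_left_inv h.conj_mul
  have := Matrix.exp_conj W (rdiag p)
    ((isUnit_iff_isUnit_det W).2 (isUnit_det_of_left_inverse h.conj_mul))
  rw [hW] at this
  rw [h.eq, this, exp_diagonal]
  congr 3
  ext i
  rw [Pi.coe_exp]
  simp [Complex.exp_eq_exp_ℂ]

lemma IsSpectralDecomposition.smul {A W : Matrix n n ℂ} {p : n → ℝ}
    (h : IsSpectralDecomposition A W p) (c : ℝ) :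
    IsSpectralDecomposition ((c : ℂ) • A) W (fun i => c * p i) := by
  refine ⟨h.1, ?_⟩
  have : (fun y => ((c * p y : ℝ) : ℂ)) = (c : ℂ) • fun y => (p y : ℂ) := by ext; simp
  rw [this, diagonal_smul, Matrix.mul_smul, Matrix.smul_mul, ← h.2]

lemma IsSpectralDecomposition.eigenvalue_eq {A W : Matrix n n ℂ} {p : n → ℝ}
    (h : IsSpectralDecomposition A W p) : Wᴴ * A * W = rdiag p := by
  rw [h.eq]
  calc Wᴴ * (W * rdiag p * Wᴴ) * W = (Wᴴ * W) * rdiag p * (Wᴴ * W) := by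
        simp only [Matrix.mul_assoc]
    _ = _ := by rw [h.conj_mul, Matrix.one_mul, Matrix.mul_one]

lemma IsSpectralDecomposition.posSemidef_iff {A W : Matrix n n ℂ} {p : n → ℝ}
    (h : IsSpectralDecomposition A W p) : A.PosSemidef ↔ ∀ i, 0 ≤ p i := by
  refine ⟨fun hA i => ?_, fun hp => h.eq ▸ conj_rdiag_posSemidef W hp⟩
  have := (h.eigenvalue_eq ▸ hA.conjTranspose_mul_mul_same W).diag_nonneg (i := i)
  simpa using this

lemma IsSpectralDecomposition.one_sub {A W : Matrix n n ℂ} {p : n → ℝ}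
    (h : IsSpectralDecomposition A W p) (c : ℝ) :
    IsSpectralDecomposition ((c : ℂ) • (1 : Matrix n n ℂ) - A) W (fun i => c - p i) := by
  refine ⟨h.1, ?_⟩
  have : (diagonal fun y => ((c - p y : ℝ) : ℂ)) = (c : ℂ) • (1 : Matrix n n ℂ) - rdiag p := by
    rw [← diagonal_one, ← diagonal_smul, diagonal_sub]; simp
  rw [this, Matrix.mul_sub, Matrix.sub_mul, ← h.2, Matrix.mul_smul, Matrix.smul_mul,
    Matrix.mul_one, h.mul_conj]

/-- The nonzero eigenvalues of `Y Yᴴ` and `Yᴴ Y` agree with multiplicity. -/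
lemma sum_eigenvalues_mul_conjTranspose {Y : Matrix m n ℂ} {W : Matrix m m ℂ} {p : m → ℝ}
    {W' : Matrix n n ℂ} {p' : n → ℝ} (h : IsSpectralDecomposition (Y * Yᴴ) W p)
    (h' : IsSpectralDecomposition (Yᴴ * Y) W' p') {f : ℝ → ℝ} (hf : f 0 = 0) :
    ∑ i, f (p i) = ∑ j, f (p' j) := by
  -- In the two eigenbases the squares `‖V i j‖ ^ 2` have row sums `p` and column sums `p'`, and are
  -- supported where `p i = p' j`.
  set V := Wᴴ * Y * W' with hV
  have e1 : V * Vᴴ = rdiag p := by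
    rw [← h.eigenvalue_eq, hV]
    simp only [conjTranspose_mul, conjTranspose_conjTranspose]
    calc Wᴴ * Y * W' * (W'ᴴ * (Yᴴ * W)) = Wᴴ * Y * (W' * W'ᴴ) * (Yᴴ * W) := by
          simp only [Matrix.mul_assoc]
      _ = _ := by rw [h'.mul_conj]; simp only [Matrix.mul_one, Matrix.mul_assoc]
  have e2 : Vᴴ * V = rdiag p' := by
    rw [← h'.eigenvalue_eq, hV]
    simp only [conjTranspose_mul, conjTranspose_conjTranspose]
    calc W'ᴴ * (Yᴴ * W) * (Wᴴ * Y * W') = W'ᴴ * Yᴴ * (W * Wᴴ) * (Y * W') := by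
          simp only [Matrix.mul_assoc]
      _ = _ := by rw [h.mul_conj]; simp only [Matrix.mul_one, Matrix.mul_assoc]
  have e3 : rdiag p * V = V * rdiag p' := by rw [← e1, ← e2, Matrix.mul_assoc]
  have s1 : ∀ i, ∑ j, ‖V i j‖ ^ 2 = p i := fun i => by
    have := congr_fun (congr_fun e1 i) i
    simp only [mul_apply, conjTranspose_apply, RCLike.star_def, Complex.mul_conj', rdiag,
      diagonal_apply_eq] at this
    exact_mod_cast this
  have s2 : ∀ j, ∑ i, ‖V i j‖ ^ 2 = p' j := fun i => by
    have := congr_fun (congr_fun e2 i) i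
    simp only [mul_apply, conjTranspose_apply, RCLike.star_def, Complex.conj_mul', rdiag,
      diagonal_apply_eq] at this
    exact_mod_cast this
  have s3 : ∀ i j, ‖V i j‖ ^ 2 * (f (p i) / p i) = ‖V i j‖ ^ 2 * (f (p' j) / p' j) := by
    intro i j
    have := congr_fun (congr_fun e3 i) j
    simp only [rdiag, diagonal_mul, mul_diagonal] at this
    by_cases h0 : V i j = 0
    · simp [h0]
    · rw [mul_comm] at this
      have := mul_left_cancel₀ h0 this
      have : p i = p' j := by exact_mod_cast this
      rw [this]
  -- At `x = 0` this is where `f 0 = 0` enters: the multiplicities of the eigenvalue zero may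
  -- differ.
  have s4 : ∀ x, f x = x * (f x / x) := fun x => by
    by_cases hx : x = 0
    · simp [hx, hf]
    · field_simp
  calc ∑ i, f (p i) = ∑ i, ∑ j, ‖V i j‖ ^ 2 * (f (p i) / p i) := by
        refine Finset.sum_congr rfl fun i _ => ?_
        rw [← Finset.sum_mul, s1, ← s4]
    _ = ∑ i, ∑ j, ‖V i j‖ ^ 2 * (f (p' j) / p' j) := by simp only [s3]
    _ = ∑ j, ∑ i, ‖V i j‖ ^ 2 * (f (p' j) / p' j) := Finset.sum_comm
    _ = _ := by
        refine Finset.sum_congr rfl fun j _ => ?_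
        rw [← Finset.sum_mul, s2, ← s4]

lemma trace_cfc_mul_conjTranspose (Y : Matrix m n ℂ) {f : ℝ → ℝ} (hf : f 0 = 0) :
    (cfc f (Y * Yᴴ)).trace = (cfc f (Yᴴ * Y)).trace := by
  obtain ⟨W, p, h⟩ := exists_spectralDecomposition (isHermitian_mul_conjTranspose_self Y)
  obtain ⟨W', p', h'⟩ := exists_spectralDecomposition (isHermitian_conjTranspose_mul_self Y)
  rw [h.trace_cfc, h'.trace_cfc, sum_eigenvalues_mul_conjTranspose h h' hf]

lemma IsSpectralDecomposition.transpose {A W : Matrix n n ℂ} {p : n → ℝ}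
    (h : IsSpectralDecomposition A W p) : IsSpectralDecomposition Aᵀ Wᴴᵀ p := by
  refine ⟨?_, ?_⟩
  · rw [mem_unitaryGroup_iff, star_eq_conjTranspose, ← h.conj_mul.symm.symm]
    have := congrArg Matrix.transpose h.mul_conj
    rw [transpose_mul, transpose_one] at this
    have e : Wᴴᵀᴴ = Wᵀ := by ext; simp
    rw [e, this, h.conj_mul]
  · rw [h.eq]
    have e : Wᴴᵀᴴ = Wᵀ := by ext; simp
    rw [e, transpose_mul, transpose_mul, diagonal_transpose, Matrix.mul_assoc]

lemma trace_cfc_transpose {A : Matrix n n ℂ} (hA : A.IsHermitian) (f : ℝ → ℝ) :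
    (cfc f Aᵀ).trace = (cfc f A).trace := by
  obtain ⟨W, p, h⟩ := exists_spectralDecomposition hA
  rw [h.trace_cfc, h.transpose.trace_cfc]

lemma trace_cfc_blockDiagonal {A : m → Matrix n n ℂ} (hA : ∀ i, (A i).IsHermitian)
    (f : ℝ → ℝ) : (cfc f (blockDiagonal A)).trace = ∑ i, (cfc f (A i)).trace := by
  choose W p h using fun i => exists_spectralDecomposition (hA i)
  have hb : IsSpectralDecomposition (blockDiagonal A) (blockDiagonal W) (fun x => p x.2 x.1) := by
    refine ⟨?_, ?_⟩
    · rw [mem_unitaryGroup_iff, star_eq_conjTranspose, blockDiagonal_conjTranspose,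
        ← blockDiagonal_mul]
      simp only [(h _).mul_conj]
      exact blockDiagonal_one
    · have : (diagonal fun y : n × m => ((p y.2 y.1 : ℝ) : ℂ)) =
          blockDiagonal fun i => rdiag (p i) :=
        (blockDiagonal_diagonal fun i k => ((p i k : ℝ) : ℂ)).symm
      rw [this, blockDiagonal_conjTranspose, ← blockDiagonal_mul, ← blockDiagonal_mul]
      congr 1
      ext1 i
      exact (h i).2
  rw [hb.trace_cfc, Fintype.sum_prod_type_right]
  simp [(h _).trace_cfc]

end Spectral

/-! ### The Lie product formula. -/

section Trotter
open Filter Topology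

lemma norm_pow_sub_pow_le {R : Type*} [NormedRing R] [NormOneClass R] {x y : R} {c : ℝ}
    (hc : 1 ≤ c) (hx : ‖x‖ ≤ c) (hy : ‖y‖ ≤ c) (k : ℕ) :
    ‖x ^ k - y ^ k‖ ≤ k * ‖x - y‖ * c ^ k := by
  induction k with
  | zero => simp
  | succ k ih =>
    have e : x ^ (k + 1) - y ^ (k + 1) = x ^ k * (x - y) + (x ^ k - y ^ k) * y := by
      rw [pow_succ, pow_succ]; noncomm_ring
    have h1 : ‖x ^ k * (x - y)‖ ≤ c ^ k * ‖x - y‖ :=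
      (norm_mul_le _ _).trans (mul_le_mul_of_nonneg_right
        ((norm_pow_le _ _).trans (pow_le_pow_left₀ (norm_nonneg _) hx k)) (norm_nonneg _))
    have h2 : ‖(x ^ k - y ^ k) * y‖ ≤ (k * ‖x - y‖ * c ^ k) * c :=
      (norm_mul_le _ _).trans (mul_le_mul ih hy (norm_nonneg _) (by positivity))
    have h3 : c ^ k * ‖x - y‖ ≤ c ^ (k + 1) * ‖x - y‖ := by
      exact mul_le_mul_of_nonneg_right (pow_le_pow_right₀ hc k.le_succ) (norm_nonneg _)
    rw [e]
    refine (norm_add_le _ _).trans ?_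
    push_cast
    calc _ ≤ c ^ (k + 1) * ‖x - y‖ + (k * ‖x - y‖ * c ^ k) * c := by linarith
      _ = _ := by ring

/-- Two curves through `1` with the same velocity have asymptotically equal powers. -/
lemma tendsto_pow_sub_pow {R : Type*} [NormedRing R] [NormOneClass R] [NormedAlgebra ℝ R]
    {P Q : ℝ → R} {D : R} (hP0 : P 0 = 1) (hQ0 : Q 0 = 1) (hP : HasDerivAt P D 0)
    (hQ : HasDerivAt Q D 0) :
    Tendsto (fun k : ℕ => P (1 / (k : ℝ)) ^ k - Q (1 / (k : ℝ)) ^ k) atTop (𝓝 0) := by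
  have hu : Tendsto (fun k : ℕ => 1 / (k : ℝ)) atTop (𝓝 0) := tendsto_one_div_atTop_nhds_zero_nat
  -- With this bound the `k`-th powers stay below `exp (‖D‖ + 1)`.
  have bd : ∀ {P : ℝ → R}, P 0 = 1 → HasDerivAt P D 0 →
      ∀ᶠ k : ℕ in atTop, ‖P (1 / (k : ℝ))‖ ≤ 1 + (‖D‖ + 1) / k := by
    intro P hP0 hP
    have h1 := hP.isLittleO.bound (c := 1) one_pos
    filter_upwards [hu.eventually h1, eventually_gt_atTop 0] with k hk hk0
    have hk' : (0 : ℝ) < k := by exact_mod_cast hk0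
    simp only [hP0, sub_zero, Real.norm_eq_abs, one_mul] at hk
    rw [abs_of_pos (by positivity)] at hk
    have e : P (1 / (k : ℝ)) = (P (1 / (k : ℝ)) - 1 - (1 / (k : ℝ)) • D) + 1 + (1 / (k : ℝ)) • D := by
      abel
    rw [e]
    refine (norm_add_le _ _).trans ?_
    have h3 : ‖(1 / (k : ℝ)) • D‖ = 1 / k * ‖D‖ := by
      rw [norm_smul, Real.norm_eq_abs, abs_of_pos (by positivity)]
    have h4 := norm_add_le (P (1 / (k : ℝ)) - 1 - (1 / (k : ℝ)) • D) 1
    rw [norm_one] at h4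
    rw [h3]
    calc _ ≤ 1 / (k : ℝ) + 1 + 1 / k * ‖D‖ := by linarith
      _ = _ := by ring
  -- Equal velocities make the difference `o(1 / k)`, which absorbs the factor `k` from telescoping
  -- the powers.
  have hd : Tendsto (fun k : ℕ => (k : ℝ) * ‖P (1 / (k : ℝ)) - Q (1 / (k : ℝ))‖) atTop (𝓝 0) := by
    have h1 := (hP.sub hQ).isLittleO
    simp only [Pi.sub_apply, hP0, hQ0, sub_self, sub_zero, smul_zero] at h1
    have h2 := ((h1.comp_tendsto hu).norm_left).tendsto_div_nhds_zero
    refine h2.congr fun k => ?_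
    simp [mul_comm]
  have hfin : Tendsto (fun k : ℕ => (k : ℝ) * ‖P (1 / (k : ℝ)) - Q (1 / (k : ℝ))‖ *
      Real.exp (‖D‖ + 1)) atTop (𝓝 0) := by
    simpa using hd.mul_const (Real.exp (‖D‖ + 1))
  refine squeeze_zero_norm' ?_ hfin
  filter_upwards [bd hP0 hP, bd hQ0 hQ, eventually_gt_atTop 0] with k h1 h2 hk0
  have hk' : (0 : ℝ) < k := by exact_mod_cast hk0
  refine (norm_pow_sub_pow_le (c := 1 + (‖D‖ + 1) / k) (le_add_of_nonneg_right (by positivity))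
    h1 h2 k).trans ?_
  gcongr
  calc (1 + (‖D‖ + 1) / (k : ℝ)) ^ k ≤ (Real.exp ((‖D‖ + 1) / k)) ^ k := by
        gcongr
        rw [add_comm]
        exact Real.add_one_le_exp _
    _ = _ := by
        rw [← Real.exp_nat_mul]
        congr 1
        field_simp

/-- The curves `exp (t A) exp (t B)` and `exp (t (A + B))` both have velocity `A + B` at `0`, and
the `k`-th power of the second at `1 / k` is constant. -/
lemma tendsto_exp_mul_exp_pow {R : Type*} [NormedRing R] [NormOneClass R] [NormedAlgebra ℝ R]
    [CompleteSpace R] (A B : R) :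
    Tendsto (fun k : ℕ => (NormedSpace.exp ((1 / (k : ℝ)) • A) *
      NormedSpace.exp ((1 / (k : ℝ)) • B)) ^ k) atTop (𝓝 (NormedSpace.exp (A + B))) := by
  have hd : ∀ X : R, HasDerivAt (fun t : ℝ => NormedSpace.exp (t • X)) X 0 := by
    intro X
    have := hasDerivAt_exp_smul_const (𝕂 := ℝ) X (0 : ℝ)
    simpa using this
  have hP : HasDerivAt (fun t : ℝ => NormedSpace.exp (t • A) * NormedSpace.exp (t • B))
      (A + B) 0 := by
    have := (hd A).mul (hd B)
    simp only [zero_smul, NormedSpace.exp_zero, mul_one, one_mul] at this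
    exact this
  have := (tendsto_pow_sub_pow (by simp) (by simp) hP (hd (A + B))).add_const
    (NormedSpace.exp (A + B))
  rw [zero_add] at this
  refine this.congr' ?_
  filter_upwards [eventually_gt_atTop 0] with k hk
  have hk' : (k : ℝ) ≠ 0 := by exact_mod_cast hk.ne'
  let _ : NormedAlgebra ℚ R := NormedAlgebra.restrictScalars ℚ ℝ R
  have e : NormedSpace.exp (A + B) = NormedSpace.exp ((1 / (k : ℝ)) • (A + B)) ^ k := by
    rw [← NormedSpace.exp_nsmul, ← Nat.cast_smul_eq_nsmul ℝ, smul_smul, mul_one_div_cancel hk',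
      one_smul]
  rw [← e, sub_add_cancel]

open scoped Matrix.Norms.Operator in
lemma tendsto_matrix_exp_mul_exp_pow {n : Type*} [Fintype n] [DecidableEq n] [Nonempty n]
    (A B : Matrix n n ℂ) :
    Tendsto (fun k : ℕ => (NormedSpace.exp ((1 / (k : ℝ)) • A) *
      NormedSpace.exp ((1 / (k : ℝ)) • B)) ^ k) atTop (𝓝 (NormedSpace.exp (A + B))) := by
  have := tendsto_exp_mul_exp_pow A B
  convert this
  all_goals rfl

end Trotter

/-! ### The Golden–Thompson inequality. -/

section GoldenThompson
open Filter Topology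

variable {n : Type*} [Fintype n] [DecidableEq n]

lemma trace_mul_pow_comm (X Y : Matrix n n ℂ) (k : ℕ) :
    ((X * Y) ^ k).trace = ((Y * X) ^ k).trace := by
  cases k with
  | zero => simp
  | succ k =>
    have h : X * (Y * X) ^ k = (X * Y) ^ k * X :=
      (SemiconjBy.pow_right (show X * (Y * X) = (X * Y) * X by rw [Matrix.mul_assoc]) k)
    rw [pow_succ, ← Matrix.mul_assoc, ← h, pow_succ, Matrix.mul_assoc, trace_mul_comm X,
      Matrix.mul_assoc]

lemma trace_mul_conjTranspose_eq (X : Matrix n n ℂ) :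
    (X * Xᴴ).trace = ((∑ i, ∑ j, ‖X i j‖ ^ 2 : ℝ) : ℂ) := by
  simp [trace, mul_apply, Complex.mul_conj']

lemma norm_trace_mul_le (X Y : Matrix n n ℂ) :
    ‖(X * Y).trace‖ ≤ (‖(X * Xᴴ).trace‖ + ‖(Y * Yᴴ).trace‖) / 2 := by
  have h0 : ∀ X : Matrix n n ℂ, ‖(X * Xᴴ).trace‖ = ∑ i, ∑ j, ‖X i j‖ ^ 2 := fun X => by
    rw [trace_mul_conjTranspose_eq, Complex.norm_real, Real.norm_of_nonneg]
    positivity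
  rw [h0, h0, Finset.sum_comm (f := fun i j => ‖Y i j‖ ^ 2), ← Finset.sum_add_distrib,
    Finset.sum_div]
  simp only [trace, diag_apply, mul_apply]
  refine (norm_sum_le _ _).trans (Finset.sum_le_sum fun i _ => ?_)
  rw [← Finset.sum_add_distrib, Finset.sum_div]
  refine (norm_sum_le _ _).trans (Finset.sum_le_sum fun j _ => ?_)
  rw [norm_mul]
  nlinarith [sq_nonneg (‖X i j‖ - ‖Y j i‖)]

/-- The two bounds feed each other. For the first, apply the second to `Z = A * B`, rotate
cyclically to `A² B²`, and use the first on the squares. For the second, apply it to `Z²`, rotate to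
`(Zᴴ Z)(Z Zᴴ)`, use the first, and finish with the Cauchy–Schwarz type bound `norm_trace_mul_le`. -/
lemma norm_trace_pow_two_pow_le (k : ℕ) :
    (∀ A B : Matrix n n ℂ, A.IsHermitian → B.IsHermitian →
      ‖((A * B) ^ 2 ^ k).trace‖ ≤ ‖(A ^ 2 ^ k * B ^ 2 ^ k).trace‖) ∧
    (∀ Z : Matrix n n ℂ, ‖(Z ^ 2 ^ (k + 1)).trace‖ ≤ ‖((Z * Zᴴ) ^ 2 ^ k).trace‖) := by
  induction k with
  | zero =>
    refine ⟨fun A B _ _ => by simp, fun Z => ?_⟩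
    have := norm_trace_mul_le Z Z
    simpa [pow_two] using this
  | succ k ih =>
    obtain ⟨hG, hL⟩ := ih
    refine ⟨fun A B hA hB => ?_, fun Z => ?_⟩
    · refine (hL (A * B)).trans ?_
      have e : ((A * B * (A * B)ᴴ) ^ 2 ^ k).trace = ((A ^ 2 * B ^ 2) ^ 2 ^ k).trace := by
        rw [conjTranspose_mul, hA.eq, hB.eq, Matrix.mul_assoc A, trace_mul_pow_comm A,
          ← Matrix.mul_assoc, Matrix.mul_assoc (B * B), trace_mul_pow_comm, pow_two, pow_two]
      rw [e]
      refine (hG _ _ (hA.pow 2) (hB.pow 2)).trans_eq ?_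
      rw [← pow_mul, ← pow_mul, ← pow_succ']
    · have h1 : Z ^ 2 ^ (k + 1 + 1) = (Z * Z) ^ 2 ^ (k + 1) := by
        rw [← pow_two, ← pow_mul, ← pow_succ']
      have e : ((Z * Z * (Z * Z)ᴴ) ^ 2 ^ k).trace = ((Zᴴ * Z * (Z * Zᴴ)) ^ 2 ^ k).trace := by
        rw [conjTranspose_mul, ← Matrix.mul_assoc, trace_mul_pow_comm _ Zᴴ]
        simp only [Matrix.mul_assoc]
      rw [h1]
      refine (hL _).trans ?_
      rw [e]
      refine (hG _ _ (isHermitian_conjTranspose_mul_self Z)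
        (isHermitian_mul_conjTranspose_self Z)).trans ?_
      refine (norm_trace_mul_le _ _).trans_eq ?_
      rw [((isHermitian_conjTranspose_mul_self Z).pow _).eq,
        ((isHermitian_mul_conjTranspose_self Z).pow _).eq, ← pow_add, ← pow_add,
        trace_mul_pow_comm Zᴴ, pow_succ 2 k, mul_two]
      ring

/-- The **Golden–Thompson inequality**. -/
theorem golden_thompson {A B : Matrix n n ℂ} (hA : A.IsHermitian) (hB : B.IsHermitian) :
    ‖(NormedSpace.exp (A + B)).trace‖ ≤ ‖(NormedSpace.exp A * NormedSpace.exp B).trace‖ := by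
  cases isEmpty_or_nonempty n
  · simp [trace]
  -- The limit is taken along powers of two, where the trace inequality is available.
  have h1 := (tendsto_matrix_exp_mul_exp_pow A B).comp
    (tendsto_pow_atTop_atTop_of_one_lt (one_lt_two (α := ℕ)))
  have h2 : Continuous fun X : Matrix n n ℂ => ‖X.trace‖ := by fun_prop
  refine le_of_tendsto ((h2.tendsto _).comp h1) (Eventually.of_forall fun k => ?_)
  have hs : ∀ {X : Matrix n n ℂ}, X.IsHermitian → ∀ t : ℝ, (t • X).IsHermitian := by
    intro X hX t
    rw [IsHermitian, conjTranspose_smul, hX.eq, star_trivial]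
  refine ((norm_trace_pow_two_pow_le k).1 _ _ (hs hA _).exp (hs hB _).exp).trans_eq ?_
  have he : ∀ X : Matrix n n ℂ,
      NormedSpace.exp ((1 / ((2 ^ k : ℕ) : ℝ)) • X) ^ 2 ^ k = NormedSpace.exp X := by
    intro X
    rw [← Matrix.exp_nsmul, ← Nat.cast_smul_eq_nsmul ℝ, smul_smul, mul_one_div_cancel (by positivity),
      one_smul]
  rw [he, he]

end GoldenThompson

/-! ### The matrix Chernoff bound. -/

section Chernoff

variable {n : Type*} [Fintype n] [DecidableEq n]

lemma trace_mul_nonneg {A B : Matrix n n ℂ} (hA : A.PosSemidef) (hB : B.PosSemidef) :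
    0 ≤ (A * B).trace := by
  obtain ⟨L, rfl⟩ := CStarAlgebra.nonneg_iff_eq_star_mul_self.1 hB.nonneg
  rw [← Matrix.mul_assoc, trace_mul_comm, ← Matrix.mul_assoc]
  exact (hA.mul_mul_conjTranspose_same L).trace_nonneg

lemma re_trace_mul_le {A A' B : Matrix n n ℂ} (hA : A ≤ A') (hB : B.PosSemidef) :
    (A * B).trace.re ≤ (A' * B).trace.re := by
  have := (Complex.nonneg_iff.1 (trace_mul_nonneg (le_iff.1 hA) hB)).1
  rw [Matrix.sub_mul, trace_sub, Complex.sub_re] at this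
  linarith

lemma exp_posSemidef {A : Matrix n n ℂ} (hA : A.IsHermitian) :
    (NormedSpace.exp A).PosSemidef := by
  obtain ⟨W, p, h⟩ := exists_spectralDecomposition hA
  rw [h.exp_eq]
  exact conj_rdiag_posSemidef W fun i => (Real.exp_pos _).le

lemma re_trace_exp_add_le {A B : Matrix n n ℂ} (hA : A.IsHermitian) (hB : B.IsHermitian) :
    (NormedSpace.exp (A + B)).trace.re ≤ (NormedSpace.exp A * NormedSpace.exp B).trace.re := by
  have h := Complex.nonneg_iff.1 (trace_mul_nonneg (exp_posSemidef hA) (exp_posSemidef hB))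
  calc _ ≤ _ := Complex.re_le_norm _
    _ ≤ _ := golden_thompson hA hB
    _ = |(NormedSpace.exp A * NormedSpace.exp B).trace.re| :=
        (Complex.abs_re_eq_norm.2 h.2.symm).symm
    _ = _ := abs_of_nonneg h.1

lemma IsSpectralDecomposition.smul_one_add_smul {A W : Matrix n n ℂ} {p : n → ℝ}
    (h : IsSpectralDecomposition A W p) (b c : ℝ) :
    IsSpectralDecomposition ((b : ℂ) • (1 : Matrix n n ℂ) + (c : ℂ) • A) W
      (fun i => b + c * p i) := by
  have := (h.smul (-c)).one_sub b
  convert this using 2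
  · push_cast; rw [neg_smul, sub_neg_eq_add]
  · ring

/-- On eigenvalues this is the chord bound `exp (θ x) ≤ 1 + (exp θ - 1) x` for `x = p i / K` in `[0,
1]`, from convexity. -/
lemma exp_smul_le {A : Matrix n n ℂ} {K θ : ℝ} (hK : 0 < K) (hA : A.PosSemidef)
    (hAK : ((K : ℂ) • 1 - A).PosSemidef) :
    NormedSpace.exp (((θ / K : ℝ) : ℂ) • A) ≤
      1 + (((Real.exp θ - 1) / K : ℝ) : ℂ) • A := by
  obtain ⟨W, p, h⟩ := exists_spectralDecomposition hA.1
  have hp := h.posSemidef_iff.1 hA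
  have hpK := (h.one_sub K).posSemidef_iff.1 hAK
  have h1 := (h.smul_one_add_smul 1 ((Real.exp θ - 1) / K)).eq
  rw [Complex.ofReal_one, one_smul] at h1
  rw [(h.smul (θ / K)).exp_eq, h1, le_iff, ← Matrix.sub_mul, ← Matrix.mul_sub, diagonal_sub]
  have e : (diagonal fun i => (((1 + (Real.exp θ - 1) / K * p i : ℝ) : ℂ) -
      ((Real.exp (θ / K * p i) : ℝ) : ℂ))) =
      rdiag fun i => 1 + (Real.exp θ - 1) / K * p i - Real.exp (θ / K * p i) := by
    congr 1; ext; push_cast; ring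
  rw [e]
  refine conj_rdiag_posSemidef W fun i => ?_
  have hx1 : p i / K ≤ 1 := (div_le_one hK).2 (by linarith [hpK i])
  have hx0 : 0 ≤ p i / K := div_nonneg (hp i) hK.le
  have := convexOn_exp.2 (Set.mem_univ 0) (Set.mem_univ θ) (sub_nonneg.2 hx1) hx0 (by ring)
  simp only [smul_eq_mul, mul_zero, zero_add, Real.exp_zero, mul_one] at this
  have e1 : p i / K * θ = θ / K * p i := by ring
  have e2 : (Real.exp θ - 1) / K * p i = p i / K * (Real.exp θ - 1) := by ring
  rw [e1] at this
  rw [e2]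
  linarith

variable {α : Type*} [Fintype α]

lemma sum_fin_succ_fun {M : ℕ} (F : (Fin (M + 1) → α) → ℝ) :
    ∑ C, F C = ∑ C : Fin M → α, ∑ w, F (Fin.cons w C) := by
  rw [← (Fin.consEquiv fun _ => α).sum_comp, Fintype.sum_prod_type_right]
  rfl

variable {P : α → ℝ} {X : α → Matrix n n ℂ} {K : ℝ}

/-- The Ahlswede–Winter argument: Golden–Thompson splits off one summand, whose averaged exponential
is at most `(1 + c) • 1` by the chord bound and the mean bound. Each summand thus costs a factor `1
+ c`, starting from `trace 1 = card n`. -/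
lemma sum_prod_mul_trace_exp_le (hP0 : ∀ w, 0 ≤ P w) (hP1 : ∑ w, P w = 1) (hK : 0 < K)
    (hX0 : ∀ w, (X w).PosSemidef) (hXK : ∀ w, ((K : ℂ) • 1 - X w).PosSemidef)
    (hmean : ∑ w, (P w : ℂ) • X w ≤ 1) {θ : ℝ} (hθ : 0 ≤ θ) (M : ℕ) :
    ∑ C : Fin M → α, (∏ l, P (C l)) *
      (NormedSpace.exp (((θ / K : ℝ) : ℂ) • ∑ l, X (C l))).trace.re ≤
      Fintype.card n * (1 + (Real.exp θ - 1) / K) ^ M := by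
  induction M with
  | zero => simp
  | succ M ih =>
    set t : ℂ := ((θ / K : ℝ) : ℂ)
    set c : ℝ := (Real.exp θ - 1) / K
    have hc : 0 ≤ c := div_nonneg (by linarith [Real.one_le_exp hθ]) hK.le
    have hH : ∀ A : Matrix n n ℂ, A.IsHermitian → (t • A).IsHermitian := fun A hA => by
      rw [IsHermitian, conjTranspose_smul, hA.eq]; simp [t]
    have hmgf : ∑ w, (P w : ℂ) • NormedSpace.exp (t • X w) ≤ ((1 + c : ℝ) : ℂ) • 1 := by
      calc ∑ w, (P w : ℂ) • NormedSpace.exp (t • X w)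
          ≤ ∑ w, (P w : ℂ) • (1 + (c : ℂ) • X w) := Finset.sum_le_sum fun w _ => by
            rw [le_iff, ← smul_sub]
            exact (le_iff.1 (exp_smul_le hK (hX0 w) (hXK w))).smul (by simpa using hP0 w)
        _ = 1 + (c : ℂ) • ∑ w, (P w : ℂ) • X w := by
            simp only [smul_add, Finset.sum_add_distrib, ← Finset.sum_smul, Finset.smul_sum,
              smul_comm (c : ℂ)]
            rw [← Complex.ofReal_sum, hP1, Complex.ofReal_one, one_smul]
        _ ≤ 1 + (c : ℂ) • 1 := by
            rw [le_iff, add_sub_add_left_eq_sub, ← smul_sub]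
            exact (le_iff.1 hmean).smul (by simpa using hc)
        _ = _ := by rw [Complex.ofReal_add, add_smul, Complex.ofReal_one, one_smul]
    rw [sum_fin_succ_fun]
    have step : ∀ C : Fin M → α,
        ∑ w, (∏ l, P ((Fin.cons w C : Fin (M + 1) → α) l)) *
          (NormedSpace.exp (t • ∑ l, X ((Fin.cons w C : Fin (M + 1) → α) l))).trace.re ≤
        (1 + c) * ((∏ l, P (C l)) * (NormedSpace.exp (t • ∑ l, X (C l))).trace.re) := by
      intro C
      have hS : (∑ l, X (C l)).IsHermitian := (posSemidef_sum _ fun l _ => hX0 (C l)).1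
      have hpr : 0 ≤ ∏ l, P (C l) := Finset.prod_nonneg fun l _ => hP0 _
      simp only [Fin.prod_univ_succ, Fin.sum_univ_succ, Fin.cons_zero, Fin.cons_succ, smul_add]
      calc _ ≤ ∑ w, (P w * ∏ l, P (C l)) * (NormedSpace.exp (t • X w) *
              NormedSpace.exp (t • ∑ l, X (C l))).trace.re :=
            Finset.sum_le_sum fun w _ => mul_le_mul_of_nonneg_left
              (re_trace_exp_add_le (hH _ (hX0 w).1) (hH _ hS)) (mul_nonneg (hP0 w) hpr)
        _ = (∏ l, P (C l)) * ((∑ w, (P w : ℂ) • NormedSpace.exp (t • X w)) *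
              NormedSpace.exp (t • ∑ l, X (C l))).trace.re := by
            rw [Finset.sum_mul, trace_sum, Complex.re_sum, Finset.mul_sum]
            refine Finset.sum_congr rfl fun w _ => ?_
            rw [Matrix.smul_mul, trace_smul, smul_eq_mul, Complex.re_ofReal_mul]
            ring
        _ ≤ (∏ l, P (C l)) * (((1 + c : ℝ) : ℂ) • (1 : Matrix n n ℂ) *
              NormedSpace.exp (t • ∑ l, X (C l))).trace.re :=
            mul_le_mul_of_nonneg_left (re_trace_mul_le hmgf (exp_posSemidef (hH _ hS))) hpr
        _ = _ := by
            rw [Matrix.smul_mul, Matrix.one_mul, trace_smul, smul_eq_mul, Complex.re_ofReal_mul]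
            ring
    refine (Finset.sum_le_sum fun C _ => step C).trans ?_
    rw [← Finset.mul_sum, pow_succ]
    calc _ ≤ (1 + c) * (Fintype.card n * (1 + c) ^ M) :=
          mul_le_mul_of_nonneg_left ih (by linarith)
      _ = _ := by ring

open Classical in
/-- Upper-tail **matrix Chernoff bound** for independent identically distributed random positive
semidefinite matrices. -/
theorem matrix_chernoff (hP0 : ∀ w, 0 ≤ P w) (hP1 : ∑ w, P w = 1) (hK : 0 < K)
    (hX0 : ∀ w, (X w).PosSemidef) (hXK : ∀ w, ((K : ℂ) • 1 - X w).PosSemidef)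
    (hmean : ∑ w, (P w : ℂ) • X w ≤ 1) {η : ℝ} (hη : η ∈ Set.Ioo (0 : ℝ) 1) (M : ℕ) :
    ∑ C : Fin M → α, (∏ l, P (C l)) *
      (if ((((1 + η) * M : ℝ) : ℂ) • 1 - ∑ l, X (C l)).PosSemidef then 0 else 1) ≤
      Fintype.card n * Real.exp (-(η ^ 2 * M / (4 * K))) := by
  obtain ⟨hη0, hη1⟩ := hη
  -- This minimizes `θ² - θ η`, the bound on `exp θ - 1 - θ (1 + η)` for `|θ| ≤ 1`; the minimum is
  -- `-η² / 4`.
  set θ : ℝ := η / 2 with hθ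
  set s : ℝ := Real.exp (-(θ / K * ((1 + η) * M))) with hs
  -- On failure some eigenvalue exceeds `(1 + η) M`; its exponential alone makes the trace at least
  -- `s⁻¹`.
  have markov : ∀ C : Fin M → α,
      (if ((((1 + η) * M : ℝ) : ℂ) • 1 - ∑ l, X (C l)).PosSemidef then (0 : ℝ) else 1) ≤
      (NormedSpace.exp (((θ / K : ℝ) : ℂ) • ∑ l, X (C l))).trace.re * s := by
    intro C
    have hS : (∑ l, X (C l)).IsHermitian := (posSemidef_sum _ fun l _ => hX0 (C l)).1
    obtain ⟨W, p, h⟩ := exists_spectralDecomposition hS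
    have ht : (NormedSpace.exp (((θ / K : ℝ) : ℂ) • ∑ l, X (C l))).trace.re =
        ∑ i, Real.exp (θ / K * p i) := by
      rw [(h.smul (θ / K)).exp_eq, trace_mul_comm, ← Matrix.mul_assoc, h.conj_mul, Matrix.one_mul]
      simp only [trace, rdiag, diag_apply, diagonal_apply_eq, Complex.re_sum, Complex.ofReal_re]
    rw [ht, (h.one_sub _).posSemidef_iff]
    split_ifs with hi
    · positivity
    · push Not at hi
      obtain ⟨i, hi⟩ := hi
      have h1 : Real.exp (θ / K * p i) ≤ ∑ i, Real.exp (θ / K * p i) :=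
        Finset.single_le_sum (f := fun i => Real.exp (θ / K * p i))
          (fun i _ => (Real.exp_pos _).le) (Finset.mem_univ i)
      have h2 : 1 ≤ Real.exp (θ / K * p i) * s := by
        rw [hs, ← Real.exp_add]
        refine Real.one_le_exp ?_
        rw [← sub_eq_add_neg, ← mul_sub]
        exact mul_nonneg (by positivity) (by linarith)
      exact h2.trans (mul_le_mul_of_nonneg_right h1 (Real.exp_pos _).le)
  calc _ ≤ ∑ C : Fin M → α, (∏ l, P (C l)) *
        ((NormedSpace.exp (((θ / K : ℝ) : ℂ) • ∑ l, X (C l))).trace.re * s) :=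
        Finset.sum_le_sum fun C _ => mul_le_mul_of_nonneg_left (markov C)
          (Finset.prod_nonneg fun l _ => hP0 _)
    _ = (∑ C : Fin M → α, (∏ l, P (C l)) *
        (NormedSpace.exp (((θ / K : ℝ) : ℂ) • ∑ l, X (C l))).trace.re) * s := by
        rw [Finset.sum_mul]; simp only [mul_assoc]
    _ ≤ (Fintype.card n * (1 + (Real.exp θ - 1) / K) ^ M) * s :=
        mul_le_mul_of_nonneg_right (sum_prod_mul_trace_exp_le hP0 hP1 hK hX0 hXK hmean
          (by positivity) M) (Real.exp_pos _).le
    _ ≤ (Fintype.card n * Real.exp ((Real.exp θ - 1) / K) ^ M) * s := by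
        have : 0 ≤ (Real.exp θ - 1) / K :=
          div_nonneg (by linarith [Real.one_le_exp (x := θ) (by positivity)]) hK.le
        gcongr
        rw [add_comm]
        exact Real.add_one_le_exp _
    _ = Fintype.card n * Real.exp (M * ((Real.exp θ - 1 - θ * (1 + η)) / K)) := by
        rw [mul_assoc, hs, ← Real.exp_nat_mul, ← Real.exp_add]
        congr 2
        ring
    _ ≤ _ := by
        have h1 : Real.exp θ - 1 - θ * (1 + η) ≤ -(η ^ 2 / 4) := by
          have := (abs_le.1 (Real.abs_exp_sub_one_sub_id_le (x := θ)
            (by rw [abs_of_pos (by positivity)]; linarith))).2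
          nlinarith
        have e : -(η ^ 2 * M / (4 * K)) = M * (-(η ^ 2 / 4) / K) := by
          field_simp
        rw [e]
        gcongr

end Chernoff

/-! ### Tensor powers and projectors onto product vectors. -/

section Tensor

variable {a u : Type*} [Fintype a] [DecidableEq a] [Fintype u] [DecidableEq u] {n : ℕ}

lemma sum_prod_seq {R : Type*} [CommSemiring R] (f : Fin n → a → R) :
    ∑ x : Fin n → a, ∏ i, f i (x i) = ∏ i, ∑ y, f i y := by
  rw [Finset.prod_univ_sum, Fintype.piFinset_univ]

lemma tensorMat_mul (X Y : Fin n → Matrix a a ℂ) :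
    tensorMat X * tensorMat Y = tensorMat fun i => X i * Y i := by
  ext x y
  simp only [tensorMat, mul_apply, of_apply, ← Finset.prod_mul_distrib]
  rw [sum_prod_seq fun i z => X i (x i) z * Y i z (y i)]

lemma tensorMat_conjTranspose (X : Fin n → Matrix a a ℂ) :
    (tensorMat X)ᴴ = tensorMat fun i => (X i)ᴴ := by
  ext x y
  simp [tensorMat]

lemma tensorMat_rdiag (p : Fin n → a → ℝ) :
    (tensorMat fun i => rdiag (p i)) = rdiag fun x => ∏ i, p i (x i) := by
  ext x y
  by_cases h : x = y
  · subst h; simp [tensorMat, rdiag]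
  · obtain ⟨i, hi⟩ := Function.ne_iff.1 h
    rw [rdiag, diagonal_apply_ne _ h, tensorMat, of_apply]
    exact Finset.prod_eq_zero (Finset.mem_univ i) (diagonal_apply_ne _ hi)

lemma tensorMat_one : (tensorMat fun _ : Fin n => (1 : Matrix a a ℂ)) = 1 := by
  have h : (1 : Matrix a a ℂ) = rdiag fun _ => 1 := by simp [rdiag]
  rw [h, tensorMat_rdiag]
  simp [rdiag]

lemma IsSpectralDecomposition.tensorMat {A W : Fin n → Matrix a a ℂ} {p : Fin n → a → ℝ}
    (h : ∀ i, IsSpectralDecomposition (A i) (W i) (p i)) :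
    IsSpectralDecomposition (tensorMat A) (tensorMat W) fun x => ∏ i, p i (x i) := by
  refine ⟨?_, ?_⟩
  · rw [mem_unitaryGroup_iff, star_eq_conjTranspose, tensorMat_conjTranspose, tensorMat_mul]
    simp only [(h _).mul_conj, tensorMat_one]
  · have := tensorMat_rdiag p
    rw [rdiag] at this
    rw [← this, tensorMat_conjTranspose, tensorMat_mul, tensorMat_mul]
    congr 1
    ext1 i
    exact (h i).2

lemma sum_seqProb_smul_tensorMat (q : u → ℝ) (A : u → Matrix a a ℂ) :
    ∑ w : Fin n → u, (seqProb q w : ℂ) • tensorMat (fun i => A (w i)) =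
      tensorMat fun _ => ∑ j, (q j : ℂ) • A j := by
  ext x y
  simp only [tensorMat, Matrix.sum_apply, Matrix.smul_apply, of_apply, seqProb, smul_eq_mul, Complex.ofReal_prod,
    ← Finset.prod_mul_distrib]
  rw [sum_prod_seq fun i j => (q j : ℂ) * A j (x i) (y i)]

/-- The `0`-`1` vector of a finite set. -/
def indicatorVec {ι : Type*} [DecidableEq ι] (T : Finset ι) (x : ι) : ℝ :=
  if x ∈ T then 1 else 0

lemma seqProjector_eq (W : Fin n → Matrix a a ℂ) (T : Finset (Fin n → a)) :
    seqProjector W T = tensorMat W * rdiag (indicatorVec T) * (tensorMat W)ᴴ := by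
  ext z z'
  rw [seqProjector, Matrix.sum_apply, mul_apply]
  simp only [ketbra, vecMulVec_apply, rdiag, mul_diagonal, conjTranspose_apply, tensorMat,
    of_apply, indicatorVec, Pi.star_apply]
  rw [← Finset.sum_filter_add_sum_filter_not Finset.univ (· ∈ T)]
  rw [Finset.sum_eq_zero (s := Finset.univ.filter fun x => ¬ x ∈ T), add_zero]
  · refine Finset.sum_congr (by ext; simp) fun x hx => ?_
    simp [(Finset.mem_filter.1 hx).2]
  · intro x hx
    simp [(Finset.mem_filter.1 hx).2]

end Tensor

/-! ### Monotonicity in the Loewner order. -/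

section Order

variable {m n : Type*} [Fintype m] [DecidableEq m] [Fintype n] [DecidableEq n]

lemma conj_mono (L : Matrix m n ℂ) {A B : Matrix n n ℂ} (h : A ≤ B) :
    L * A * Lᴴ ≤ L * B * Lᴴ := by
  rw [le_iff, ← Matrix.sub_mul, ← Matrix.mul_sub]
  exact (le_iff.1 h).mul_mul_conjTranspose_same L

lemma conj_rdiag_mono (W : Matrix m n ℂ) {p q : n → ℝ} (h : ∀ i, p i ≤ q i) :
    W * rdiag p * Wᴴ ≤ W * rdiag q * Wᴴ := by
  refine conj_mono W ?_
  rw [le_iff, diagonal_sub]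
  exact PosSemidef.diagonal fun i => by simpa using h i

lemma conj_rdiag_mul {W : Matrix n n ℂ} (hW : Wᴴ * W = 1) (p q : n → ℝ) :
    W * rdiag p * Wᴴ * (W * rdiag q * Wᴴ) = W * rdiag (fun i => p i * q i) * Wᴴ := by
  calc _ = W * rdiag p * (Wᴴ * W) * rdiag q * Wᴴ := by simp only [Matrix.mul_assoc]
    _ = W * (rdiag p * rdiag q) * Wᴴ := by rw [hW, Matrix.mul_one]; simp only [Matrix.mul_assoc]
    _ = _ := by rw [rdiag_mul]

lemma conj_rdiag_const {W : Matrix n n ℂ} (hW : W * Wᴴ = 1) (c : ℝ) :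
    (W * rdiag (fun _ => c) * Wᴴ) = (c : ℂ) • 1 := by
  have : rdiag (fun _ : n => c) = (c : ℂ) • (1 : Matrix n n ℂ) := (smul_one_eq_diagonal _).symm
  rw [this, Matrix.mul_smul, Matrix.mul_one, Matrix.smul_mul, hW]

lemma real_smul_mono {A B : Matrix n n ℂ} (h : A ≤ B) {c : ℝ} (hc : 0 ≤ c) :
    (c : ℂ) • A ≤ (c : ℂ) • B := by
  rw [le_iff, ← smul_sub]
  exact (le_iff.1 h).smul (by simpa using hc)

lemma real_smul_one_mono {b c : ℝ} (h : b ≤ c) :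
    (b : ℂ) • (1 : Matrix n n ℂ) ≤ (c : ℂ) • 1 := by
  rw [le_iff, ← sub_smul]
  exact PosSemidef.one.smul (by simpa using h)

end Order

/-! ### The canonical ensemble of a measurement. -/

section Ensemble

variable {a u : Type*} [Fintype a] [DecidableEq a] [Fintype u] [DecidableEq u]
  {ρ : Matrix a a ℂ} {Λ : u → Matrix a a ℂ}

lemma msqrt_isHermitian (hρ : ρ.IsHermitian) : (msqrt ρ).IsHermitian := by
  obtain ⟨W, p, h⟩ := exists_spectralDecomposition hρ
  rw [msqrt, h.cfc_eq]
  exact conj_rdiag_isHermitian _ _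

lemma msqrt_mul_msqrt (hρ : ρ.PosSemidef) : msqrt ρ * msqrt ρ = ρ := by
  obtain ⟨W, p, h⟩ := exists_spectralDecomposition hρ.1
  rw [msqrt, h.cfc_eq, conj_rdiag_mul h.conj_mul]
  conv_rhs => rw [h.eq]
  simp [Real.mul_self_sqrt (h.posSemidef_iff.1 hρ _)]

lemma outcomeProb_nonneg (hρ : IsDensity ρ) (hΛ : IsPOVM Λ) (j : u) : 0 ≤ outcomeProb ρ Λ j :=
  (Complex.nonneg_iff.1 (trace_mul_nonneg (hΛ.1 j) hρ.1)).1

lemma ofReal_outcomeProb (hρ : IsDensity ρ) (hΛ : IsPOVM Λ) (j : u) :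
    (outcomeProb ρ Λ j : ℂ) = (Λ j * ρ).trace :=
  Complex.ext rfl (Complex.nonneg_iff.1 (trace_mul_nonneg (hΛ.1 j) hρ.1)).2

lemma sum_outcomeProb (hρ : IsDensity ρ) (hΛ : IsPOVM Λ) : ∑ j, outcomeProb ρ Λ j = 1 := by
  have : ((∑ j, outcomeProb ρ Λ j : ℝ) : ℂ) = 1 := by
    rw [Complex.ofReal_sum]
    simp only [ofReal_outcomeProb hρ hΛ]
    rw [← trace_sum, ← Finset.sum_mul, hΛ.2, Matrix.one_mul, hρ.2]
  exact_mod_cast this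

lemma sandwich_posSemidef (hρ : IsDensity ρ) (hΛ : IsPOVM Λ) (j : u) :
    (msqrt ρ * Λ j * msqrt ρ).PosSemidef := by
  have := (hΛ.1 j).mul_mul_conjTranspose_same (msqrt ρ)
  rwa [(msqrt_isHermitian hρ.1.1).eq] at this

lemma trace_sandwich (hρ : IsDensity ρ) (hΛ : IsPOVM Λ) (j : u) :
    (msqrt ρ * Λ j * msqrt ρ).trace = outcomeProb ρ Λ j := by
  rw [ofReal_outcomeProb hρ hΛ, Matrix.mul_assoc, trace_mul_comm, Matrix.mul_assoc,
    msqrt_mul_msqrt hρ.1]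

/-- This survives probability zero because a positive semidefinite matrix of trace zero vanishes. It
lets the ensemble average to `ρ` without excluding null letters. -/
lemma smul_canonicalState (hρ : IsDensity ρ) (hΛ : IsPOVM Λ) (j : u) :
    (outcomeProb ρ Λ j : ℂ) • canonicalState ρ Λ j = msqrt ρ * Λ j * msqrt ρ := by
  by_cases h : outcomeProb ρ Λ j = 0
  · have := trace_sandwich hρ hΛ j
    rw [h, Complex.ofReal_zero, (sandwich_posSemidef hρ hΛ j).trace_eq_zero_iff] at this
    rw [h, this, Complex.ofReal_zero, zero_smul]
  · rw [canonicalState, smul_smul, mul_inv_cancel₀ (by exact_mod_cast h), one_smul]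

lemma canonicalState_posSemidef (hρ : IsDensity ρ) (hΛ : IsPOVM Λ) (j : u) :
    (canonicalState ρ Λ j).PosSemidef := by
  have h := (sandwich_posSemidef hρ hΛ j).smul (a := ((outcomeProb ρ Λ j)⁻¹ : ℝ))
    (by have := outcomeProb_nonneg hρ hΛ j; positivity)
  rw [canonicalState, ← Complex.ofReal_inv]
  exact h

lemma sum_smul_canonicalState (hρ : IsDensity ρ) (hΛ : IsPOVM Λ) :
    ∑ j, (outcomeProb ρ Λ j : ℂ) • canonicalState ρ Λ j = ρ := by
  simp only [smul_canonicalState hρ hΛ]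
  rw [← Finset.sum_mul, ← Finset.mul_sum, hΛ.2, Matrix.mul_one, msqrt_mul_msqrt hρ.1]

lemma trace_canonicalState (hρ : IsDensity ρ) (hΛ : IsPOVM Λ) {j : u}
    (hj : outcomeProb ρ Λ j ≠ 0) : (canonicalState ρ Λ j).trace = 1 := by
  rw [canonicalState, trace_smul, trace_sandwich hρ hΛ, smul_eq_mul,
    inv_mul_cancel₀ (by exact_mod_cast hj)]

lemma IsSpectralDecomposition.sum_eq_one {W : Matrix a a ℂ} {p : a → ℝ}
    (h : IsSpectralDecomposition ρ W p) (ht : ρ.trace = 1) : ∑ y, p y = 1 := by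
  have := h.trace_eq
  rw [ht] at this
  exact_mod_cast this.symm

end Ensemble

/-! ### Mutual information as the Holevo quantity. -/

section MutualInfo

variable {a e s u : Type*} [Fintype a] [DecidableEq a] [Fintype e] [DecidableEq e]
  [Fintype s] [DecidableEq s] [Fintype u] [DecidableEq u]

lemma IsPOVM.coarse {Λ : s → Matrix a a ℂ} (h : IsPOVM Λ) (f : s → u) :
    IsPOVM (coarsePOVM f Λ) := by
  refine ⟨fun j => posSemidef_sum _ fun i _ => h.1 i, ?_⟩
  rw [← h.2]
  exact Finset.sum_fiberwise Finset.univ f Λ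

/-- A bipartite vector as a matrix from the first factor to the second. -/
def vecMatrix (φ : a × e → ℂ) : Matrix e a ℂ :=
  of fun k x => φ (x, k)

lemma traceFst_kronecker_mul_ketbra (Λ : Matrix a a ℂ) (φ : a × e → ℂ) :
    traceFst ((Λ ⊗ₖ (1 : Matrix e e ℂ)) * ketbra φ) =
      vecMatrix φ * Λᵀ * (vecMatrix φ)ᴴ := by
  ext k k'
  simp only [traceFst, of_apply, mul_apply, kroneckerMap_apply, Fintype.sum_prod_type, one_apply,
    ketbra, vecMulVec_apply, vecMatrix, conjTranspose_apply, transpose_apply, Pi.star_apply,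
    mul_ite, mul_one, mul_zero, ite_mul, zero_mul, Finset.sum_ite_eq, Finset.mem_univ, if_true,
    Finset.sum_mul]
  refine Finset.sum_congr rfl fun x _ => Finset.sum_congr rfl fun y _ => ?_
  ring

lemma conjTranspose_vecMatrix_mul (φ : a × e → ℂ) :
    (vecMatrix φ)ᴴ * vecMatrix φ = (traceSnd (ketbra φ))ᵀ := by
  ext x x'
  simp only [traceSnd, of_apply, mul_apply, ketbra, vecMulVec_apply, vecMatrix,
    conjTranspose_apply, transpose_apply, Pi.star_apply, mul_comm]

lemma relabel_postMeasurement (f : s → u) (Λ : s → Matrix a a ℂ) (φ : a × e → ℂ) :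
    relabel f (postMeasurement Λ (ketbra φ)) =
      blockDiagonal fun j => vecMatrix φ * (coarsePOVM f Λ j)ᵀ * (vecMatrix φ)ᴴ := by
  ext ⟨k, j⟩ ⟨k', j'⟩
  simp only [relabel, postMeasurement, of_apply, blockDiagonal_apply, if_true,
    traceFst_kronecker_mul_ketbra]
  split_ifs with h
  · rw [coarsePOVM, transpose_sum, Matrix.mul_sum, Matrix.sum_mul, Matrix.sum_apply]
  · rfl

lemma traceSnd_blockDiagonal (B : u → Matrix e e ℂ) :
    traceSnd (blockDiagonal B) = ∑ j, B j := by
  ext x y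
  simp [traceSnd, blockDiagonal_apply, Matrix.sum_apply]

lemma traceFst_blockDiagonal (B : u → Matrix e e ℂ) :
    traceFst (blockDiagonal B) = diagonal fun j => (B j).trace := by
  ext x y
  by_cases h : x = y
  · subst h; simp [traceFst, blockDiagonal_apply, trace]
  · simp [traceFst, blockDiagonal_apply, h]

lemma IsSpectralDecomposition.vnEntropy_eq {ρ W : Matrix a a ℂ} {p : a → ℝ}
    (h : IsSpectralDecomposition ρ W p) : vnEntropy ρ = shannonEntropy p := by
  rw [vnEntropy, h.trace_cfc, Complex.ofReal_re, shannonEntropy]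

lemma isSpectralDecomposition_rdiag (p : a → ℝ) : IsSpectralDecomposition (rdiag p) 1 p :=
  ⟨one_mem _, by simp⟩

/-- Write `Λᵀ = Lᴴ L`. The block is `Y Yᴴ` with `Y = vecMatrix φ * Lᴴ`, and `Yᴴ Y` depends on `φ`
only through `ρᵀ`. Replacing `vecMatrix φ` by the transpose of `msqrt ρ` therefore keeps the nonzero
spectrum, and gives the transpose of the right-hand operator. -/
lemma trace_cfc_purification_block (φ : a × e → ℂ) {ρ Λ : Matrix a a ℂ}
    (hφ : traceSnd (ketbra φ) = ρ) (hρ : ρ.PosSemidef) (hΛ : Λ.PosSemidef) {f : ℝ → ℝ}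
    (hf : f 0 = 0) :
    (cfc f (vecMatrix φ * Λᵀ * (vecMatrix φ)ᴴ)).trace =
      (cfc f (msqrt ρ * Λ * msqrt ρ)).trace := by
  obtain ⟨L, hL⟩ := CStarAlgebra.nonneg_iff_eq_star_mul_self.1 hΛ.transpose.nonneg
  rw [star_eq_conjTranspose] at hL
  set R := (msqrt ρ)ᵀ with hR
  have hs := msqrt_isHermitian hρ.1
  have hRh : Rᴴ = R := hs.transpose
  have hRR : R * R = ρᵀ := by rw [hR, ← transpose_mul, msqrt_mul_msqrt hρ]
  have e1 : vecMatrix φ * Λᵀ * (vecMatrix φ)ᴴ = (vecMatrix φ * Lᴴ) * (vecMatrix φ * Lᴴ)ᴴ := by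
    rw [hL, conjTranspose_mul, conjTranspose_conjTranspose]
    simp only [Matrix.mul_assoc]
  have e2 : (vecMatrix φ * Lᴴ)ᴴ * (vecMatrix φ * Lᴴ) = (R * Lᴴ)ᴴ * (R * Lᴴ) := by
    simp only [conjTranspose_mul, conjTranspose_conjTranspose, hRh]
    calc L * (vecMatrix φ)ᴴ * (vecMatrix φ * Lᴴ) = L * ((vecMatrix φ)ᴴ * vecMatrix φ) * Lᴴ := by
          simp only [Matrix.mul_assoc]
      _ = L * (R * R) * Lᴴ := by rw [conjTranspose_vecMatrix_mul, hφ, hRR]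
      _ = _ := by simp only [Matrix.mul_assoc]
  have e3 : (R * Lᴴ) * (R * Lᴴ)ᴴ = (msqrt ρ * Λ * msqrt ρ)ᵀ := by
    rw [transpose_mul, transpose_mul, hL, conjTranspose_mul, conjTranspose_conjTranspose, hRh]
    simp only [Matrix.mul_assoc, hR]
  have hH : (msqrt ρ * Λ * msqrt ρ).IsHermitian := by
    have := (hΛ.mul_mul_conjTranspose_same (msqrt ρ)).1
    rwa [hs.eq] at this
  rw [e1, trace_cfc_mul_conjTranspose _ hf, e2, ← trace_cfc_mul_conjTranspose _ hf, e3,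
    trace_cfc_transpose hH]

lemma canonical_eigenvalue_sum {ρ : Matrix a a ℂ} {Λ : u → Matrix a a ℂ} (hρ : IsDensity ρ)
    (hΛ : IsPOVM Λ) {j : u} {W : Matrix a a ℂ} {p : a → ℝ}
    (h : IsSpectralDecomposition (canonicalState ρ Λ j) W p) (hj : outcomeProb ρ Λ j ≠ 0) :
    ∑ y, p y = 1 :=
  h.sum_eq_one (trace_canonicalState hρ hΛ hj)

/-- The mutual information between the outcome of a measurement and the purifying systems is the
Holevo quantity of the canonical ensemble. -/
lemma mutualInfo_eq (φ : a × e → ℂ) {ρ : Matrix a a ℂ} (hφ : traceSnd (ketbra φ) = ρ)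
    (hρ : IsDensity ρ) {Λ : s → Matrix a a ℂ} (hΛ : IsPOVM Λ) (f : s → u)
    {W₀ : Matrix a a ℂ} {p₀ : a → ℝ} (h₀ : IsSpectralDecomposition ρ W₀ p₀)
    {W : u → Matrix a a ℂ} {p : u → a → ℝ}
    (h : ∀ j, IsSpectralDecomposition (canonicalState ρ (coarsePOVM f Λ) j) (W j) (p j)) :
    mutualInfo (relabel f (postMeasurement Λ (ketbra φ))) =
      shannonEntropy p₀ - ∑ j, outcomeProb ρ (coarsePOVM f Λ) j * shannonEntropy (p j) := by
  have hΛ' := hΛ.coarse f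
  set Γ := coarsePOVM f Λ
  set q := outcomeProb ρ Γ with hq
  set T : u → Matrix e e ℂ := fun j => vecMatrix φ * (Γ j)ᵀ * (vecMatrix φ)ᴴ with hT
  have hTp : ∀ j, (T j).PosSemidef := fun j =>
    (hΛ'.1 j).transpose.mul_mul_conjTranspose_same _
  have hn := Real.negMulLog_zero
  -- The two marginals of a pure state have equal entropy.
  have t1 : vnEntropy (∑ j, T j) = shannonEntropy p₀ := by
    have : ∑ j, T j = vecMatrix φ * (vecMatrix φ)ᴴ := by
      rw [hT, ← Matrix.sum_mul, ← Matrix.mul_sum, ← transpose_sum, hΛ'.2, transpose_one,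
        Matrix.mul_one]
    rw [this, vnEntropy, trace_cfc_mul_conjTranspose _ hn, conjTranspose_vecMatrix_mul, hφ,
      trace_cfc_transpose hρ.1.1, ← vnEntropy, h₀.vnEntropy_eq]
  have t2 : vnEntropy (diagonal fun j => (T j).trace) = shannonEntropy q := by
    have : (diagonal fun j => (T j).trace) = rdiag q := by
      congr 1
      ext1 j
      rw [hq, ofReal_outcomeProb hρ hΛ', hT]
      simp only
      rw [trace_mul_comm, ← Matrix.mul_assoc, conjTranspose_vecMatrix_mul, hφ, ← transpose_mul,
        trace_transpose]
    rw [this, (isSpectralDecomposition_rdiag q).vnEntropy_eq]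
  -- Chain rule: the nonzero eigenvalues of block `j` are those of `q j • canonicalState`, namely
  -- the nonzero `q j * p j y`.
  have t3 : vnEntropy (blockDiagonal T) = shannonEntropy q + ∑ j, q j * shannonEntropy (p j) := by
    rw [vnEntropy, trace_cfc_blockDiagonal fun j => (hTp j).1, Complex.re_sum, shannonEntropy,
      ← mul_div_mul_right (c := (1 : ℝ)) _ _ one_ne_zero]
    simp only [mul_one, shannonEntropy, mul_div_assoc']
    rw [← Finset.sum_div, ← add_div, ← Finset.sum_add_distrib]
    congr 1
    refine Finset.sum_congr rfl fun j _ => ?_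
    rw [hT, trace_cfc_purification_block φ hφ hρ.1 (hΛ'.1 j) hn, ← smul_canonicalState hρ hΛ' j,
      ((h j).smul _).trace_cfc, Complex.ofReal_re]
    simp only [Real.negMulLog_mul, Finset.sum_add_distrib, ← Finset.sum_mul, ← Finset.mul_sum]
    by_cases hj : outcomeProb ρ Γ j = 0
    · simp [hq, hj]
    · rw [canonical_eigenvalue_sum hρ hΛ' (h j) hj, one_mul]
  rw [relabel_postMeasurement, mutualInfo, traceSnd_blockDiagonal, traceFst_blockDiagonal, t1, t2,
    t3]
  ring

lemma conj_rdiag_apply_self (V : Matrix a a ℂ) (p : a → ℝ) (x : a) :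
    (V * rdiag p * Vᴴ) x x = ((∑ y, ‖V x y‖ ^ 2 * p y : ℝ) : ℂ) := by
  rw [mul_apply, Complex.ofReal_sum]
  refine Finset.sum_congr rfl fun y _ => ?_
  rw [rdiag, mul_diagonal, conjTranspose_apply, RCLike.star_def]
  push_cast
  rw [← Complex.mul_conj']
  ring

/-- The Holevo quantity of the canonical ensemble is nonnegative. -/
lemma sum_mul_shannonEntropy_le {ρ : Matrix a a ℂ} (hρ : IsDensity ρ) {Λ : u → Matrix a a ℂ}
    (hΛ : IsPOVM Λ) {W₀ : Matrix a a ℂ} {p₀ : a → ℝ} (h₀ : IsSpectralDecomposition ρ W₀ p₀)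
    {W : u → Matrix a a ℂ} {p : u → a → ℝ}
    (h : ∀ j, IsSpectralDecomposition (canonicalState ρ Λ j) (W j) (p j)) :
    ∑ j, outcomeProb ρ Λ j * shannonEntropy (p j) ≤ shannonEntropy p₀ := by
  set q := outcomeProb ρ Λ with hq
  -- The squared moduli of the entries of each `V j` are doubly stochastic. Row sums make `p₀ x` a
  -- convex combination of the `p j y`, so concavity of `negMulLog` applies; column sums collapse
  -- the sum over `x`.
  set V : u → Matrix a a ℂ := fun j => W₀ᴴ * W j with hV
  have hV1 : ∀ j, V j * (V j)ᴴ = 1 := fun j => by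
    rw [hV, conjTranspose_mul, conjTranspose_conjTranspose]
    calc W₀ᴴ * W j * ((W j)ᴴ * W₀) = W₀ᴴ * (W j * (W j)ᴴ) * W₀ := by simp only [Matrix.mul_assoc]
      _ = _ := by rw [(h j).mul_conj, Matrix.mul_one, h₀.conj_mul]
  have hV2 : ∀ j, (V j)ᴴ * V j = 1 := fun j => by
    rw [hV, conjTranspose_mul, conjTranspose_conjTranspose]
    calc (W j)ᴴ * W₀ * (W₀ᴴ * W j) = (W j)ᴴ * (W₀ * W₀ᴴ) * W j := by simp only [Matrix.mul_assoc]
      _ = _ := by rw [h₀.mul_conj, Matrix.mul_one, (h j).conj_mul]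
  have s1 : ∀ j x, ∑ y, ‖V j x y‖ ^ 2 = 1 := fun j x => by
    have := congr_fun (congr_fun (hV1 j) x) x
    simp only [mul_apply, conjTranspose_apply, RCLike.star_def, Complex.mul_conj',
      one_apply_eq] at this
    exact_mod_cast this
  have s2 : ∀ j y, ∑ x, ‖V j x y‖ ^ 2 = 1 := fun j y => by
    have := congr_fun (congr_fun (hV2 j) y) y
    simp only [mul_apply, conjTranspose_apply, RCLike.star_def, Complex.conj_mul',
      one_apply_eq] at this
    exact_mod_cast this
  have s3 : ∀ x, p₀ x = ∑ j, ∑ y, q j * ‖V j x y‖ ^ 2 * p j y := fun x => by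
    have e : rdiag p₀ = ∑ j, (q j : ℂ) • (V j * rdiag (p j) * (V j)ᴴ) := by
      rw [← h₀.eigenvalue_eq, ← sum_smul_canonicalState hρ hΛ, Matrix.mul_sum, Matrix.sum_mul]
      refine Finset.sum_congr rfl fun j _ => ?_
      rw [(h j).eq, hV, Matrix.mul_smul, Matrix.smul_mul, conjTranspose_mul,
        conjTranspose_conjTranspose]
      simp only [Matrix.mul_assoc, hq]
    have := congr_fun (congr_fun e x) x
    rw [Matrix.sum_apply] at this
    simp only [Matrix.smul_apply, conj_rdiag_apply_self, smul_eq_mul] at this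
    rw [rdiag, diagonal_apply_eq] at this
    have : p₀ x = ∑ j, q j * ∑ y, ‖V j x y‖ ^ 2 * p j y := by exact_mod_cast this
    simpa only [Finset.mul_sum, mul_assoc] using this
  have hp : ∀ j y, 0 ≤ p j y := fun j =>
    (h j).posSemidef_iff.1 (canonicalState_posSemidef hρ hΛ j)
  have hq0 := outcomeProb_nonneg hρ hΛ
  have s4 : ∀ x, ∑ j, ∑ y, q j * ‖V j x y‖ ^ 2 * Real.negMulLog (p j y) ≤
      Real.negMulLog (p₀ x) := fun x => by
    have := Real.concaveOn_negMulLog.le_map_sum (t := (Finset.univ : Finset (u × a)))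
      (w := fun z => q z.1 * ‖V z.1 x z.2‖ ^ 2) (p := fun z => p z.1 z.2)
      (fun z _ => mul_nonneg (hq0 _) (by positivity))
      (by
        rw [Fintype.sum_prod_type]
        simp only [← Finset.mul_sum, s1, mul_one]
        exact sum_outcomeProb hρ hΛ)
      (fun z _ => hp _ _)
    simp only [Fintype.sum_prod_type, smul_eq_mul] at this
    rwa [← s3] at this
  have s5 : ∑ j, q j * ∑ y, Real.negMulLog (p j y) ≤ ∑ x, Real.negMulLog (p₀ x) := by
    refine le_trans (le_of_eq ?_) (Finset.sum_le_sum fun x _ => s4 x)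
    rw [Finset.sum_comm]
    refine Finset.sum_congr rfl fun j _ => ?_
    rw [Finset.sum_comm, Finset.mul_sum]
    refine Finset.sum_congr rfl fun y _ => ?_
    rw [← Finset.sum_mul, ← Finset.mul_sum, s2, mul_one]
  simp only [shannonEntropy, mul_div_assoc', ← Finset.sum_div]
  exact div_le_div_of_nonneg_right s5 (Real.log_nonneg one_le_two)

end MutualInfo

/-! ### Typical sequences and their probabilities. -/

section Typical

variable {a u : Type*} [Fintype a] [DecidableEq a] [Fintype u] [DecidableEq u]

lemma countLetter_eq {n : ℕ} (w : Fin n → u) (j : u) :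
    countLetter w j = (Finset.univ.filter fun i => w i = j).card := by
  rw [countLetter, Fintype.card_subtype]

lemma countPair_eq {n : ℕ} (w : Fin n → u) (x : Fin n → a) (j : u) (y : a) :
    countPair w x j y = (Finset.univ.filter fun i => w i = j ∧ x i = y).card := by
  rw [countPair, Fintype.card_subtype]

lemma countLetter_le {n : ℕ} (w : Fin n → u) (j : u) : countLetter w j ≤ n := by
  rw [countLetter_eq]
  exact (Finset.card_le_univ _).trans_eq (Fintype.card_fin n)

lemma exists_countLetter_eq {n : ℕ} (k : u → ℕ) (hk : ∑ j, k j = n) :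
    ∃ w : Fin n → u, ∀ j, countLetter w j = k j := by
  have hc : Fintype.card (Fin n) = Fintype.card (Σ j, Fin (k j)) := by simp [hk]
  let e := Fintype.equivOfCardEq hc
  refine ⟨fun i => (e i).1, fun j => ?_⟩
  rw [countLetter, Fintype.card_congr ((e.subtypeEquiv (p := fun i => (e i).1 = j)
    (q := fun z => z.1 = j) fun _ => Iff.rfl).trans (Equiv.sigmaSubtype j)), Fintype.card_fin]

/-- Round every `n * q j` down and give the remainder to one letter of positive probability. That
letter is off by at most `card u`, and null letters receive zero. This suffices to normalize the
pruned law; no law of large numbers is needed. -/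
lemma strongTypical_nonempty {q : u → ℝ} (hq : ∀ j, 0 ≤ q j) (hq1 : ∑ j, q j = 1) {δ : ℝ}
    {n : ℕ} (hn : (Fintype.card u : ℝ) ≤ n * δ) : (strongTypical q δ n).Nonempty := by
  obtain ⟨j₀, -, hj₀⟩ : ∃ j ∈ Finset.univ, 0 < q j := by
    by_contra! h
    have := Finset.sum_nonpos h
    linarith
  set s : ℕ := ∑ j ∈ Finset.univ.erase j₀, ⌊n * q j⌋₊ with hs
  have hnq : ∀ j, 0 ≤ n * q j := fun j => mul_nonneg n.cast_nonneg (hq j)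
  have hsum : ∑ j ∈ Finset.univ.erase j₀, (n * q j) + n * q j₀ = n := by
    rw [Finset.sum_erase_add _ _ (Finset.mem_univ _), ← Finset.mul_sum, hq1, mul_one]
  have hs1 : (s : ℝ) ≤ ∑ j ∈ Finset.univ.erase j₀, (n * q j) := by
    rw [hs, Nat.cast_sum]
    exact Finset.sum_le_sum fun j _ => Nat.floor_le (hnq j)
  have hs2 : ∑ j ∈ Finset.univ.erase j₀, (n * q j) ≤ s + Fintype.card u := by
    have h1 : ∑ j ∈ Finset.univ.erase j₀, (n * q j) ≤
        ∑ j ∈ Finset.univ.erase j₀, ((⌊n * q j⌋₊ : ℝ) + 1) :=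
      Finset.sum_le_sum fun j _ => (Nat.lt_floor_add_one _).le
    rw [Finset.sum_add_distrib, ← Nat.cast_sum, Finset.sum_const, nsmul_eq_mul, mul_one] at h1
    have h2 : ((Finset.univ.erase j₀).card : ℝ) ≤ Fintype.card u := by
      exact_mod_cast Finset.card_le_univ _
    linarith
  have hsn : s ≤ n := by
    have : (s : ℝ) ≤ n := by linarith [hnq j₀]
    exact_mod_cast this
  obtain ⟨w, hw⟩ := exists_countLetter_eq (n := n)
    (fun j => if j = j₀ then n - s else ⌊n * q j⌋₊) (by
      rw [← Finset.add_sum_erase _ _ (Finset.mem_univ j₀), if_pos rfl,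
        Finset.sum_congr rfl fun j hj => if_neg (Finset.ne_of_mem_erase hj), ← hs]
      omega)
  have hcard : (1 : ℝ) ≤ Fintype.card u := by
    exact_mod_cast Fintype.card_pos_iff.2 ⟨j₀⟩
  refine ⟨w, Finset.mem_filter.2 ⟨Finset.mem_univ _, fun j => ?_⟩⟩
  rw [hw]
  split_ifs with hj
  · subst hj
    refine ⟨?_, fun h => absurd h hj₀.ne'⟩
    rw [Nat.cast_sub hsn, abs_le]
    constructor <;> linarith
  · refine ⟨?_, fun h => by simp [h]⟩
    have h1 := Nat.floor_le (hnq j)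
    have h2 := Nat.lt_floor_add_one (n * q j)
    rw [abs_le]
    constructor <;> linarith

lemma seqProb_nonneg {q : u → ℝ} (hq : ∀ j, 0 ≤ q j) {n : ℕ} (w : Fin n → u) :
    0 ≤ seqProb q w :=
  Finset.prod_nonneg fun _ _ => hq _

lemma sum_seqProb {q : u → ℝ} (hq1 : ∑ j, q j = 1) (n : ℕ) :
    ∑ w : Fin n → u, seqProb q w = 1 := by
  simp only [seqProb]
  rw [sum_prod_seq fun _ => q]
  simp [hq1]

lemma seqProb_pos_of_mem {q : u → ℝ} (hq : ∀ j, 0 ≤ q j) {δ : ℝ} {n : ℕ} {w : Fin n → u}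
    (hw : w ∈ strongTypical q δ n) : 0 < seqProb q w := by
  refine Finset.prod_pos fun i _ => (hq _).lt_of_ne' fun h => ?_
  have := ((Finset.mem_filter.1 hw).2 (w i)).2 h
  rw [countLetter_eq, Finset.card_eq_zero] at this
  have hi : i ∈ Finset.univ.filter fun k => w k = w i := by simp
  rw [this] at hi
  simp at hi

lemma typicalMass_pos {q : u → ℝ} (hq : ∀ j, 0 ≤ q j) {δ : ℝ} {n : ℕ}
    (h : (strongTypical q δ n).Nonempty) : 0 < typicalMass q δ n :=
  Finset.sum_pos (fun _ hw => seqProb_pos_of_mem hq hw) h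

lemma typicalMass_le_one {q : u → ℝ} (hq : ∀ j, 0 ≤ q j) (hq1 : ∑ j, q j = 1) (δ : ℝ) (n : ℕ) :
    typicalMass q δ n ≤ 1 :=
  (Finset.sum_le_univ_sum_of_nonneg fun w => seqProb_nonneg hq w).trans_eq (sum_seqProb hq1 n)

/-- Total of `-log₂ p` over all letters of nonzero probability. -/
noncomputable def totalSurprisal (p : u → a → ℝ) : ℝ :=
  (∑ j, ∑ y, -Real.log (p j y)) / Real.log 2

lemma totalSurprisal_nonneg {p : u → a → ℝ} (hp0 : ∀ j y, 0 ≤ p j y) (hp1 : ∀ j y, p j y ≤ 1) :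
    0 ≤ totalSurprisal p :=
  div_nonneg (Finset.sum_nonneg fun j _ => Finset.sum_nonneg fun y _ =>
    neg_nonneg.2 (Real.log_nonpos (hp0 j y) (hp1 j y))) (Real.log_nonneg one_le_two)

lemma sum_comp_pair {n : ℕ} (w : Fin n → u) (x : Fin n → a) (f : u → a → ℝ) :
    ∑ i, f (w i) (x i) = ∑ j, ∑ y, (countPair w x j y : ℝ) * f j y := by
  rw [← Finset.sum_fiberwise Finset.univ w]
  refine Finset.sum_congr rfl fun j _ => ?_
  rw [← Finset.sum_fiberwise _ x]
  refine Finset.sum_congr rfl fun y _ => ?_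
  rw [countPair_eq, ← nsmul_eq_mul, ← Finset.sum_const, Finset.filter_filter]
  refine Finset.sum_congr rfl fun i hi => ?_
  obtain ⟨h1, h2⟩ := (Finset.mem_filter.1 hi).2
  rw [h1, h2]

lemma prod_le_of_mem_condTypical {q : u → ℝ} {p : u → a → ℝ} (hp0 : ∀ j y, 0 ≤ p j y)
    (hp1 : ∀ j y, p j y ≤ 1) {δ : ℝ} (hδ : 0 ≤ δ) {n : ℕ} {w : Fin n → u}
    (hw : w ∈ strongTypical q δ n) {x : Fin n → a} (hx : x ∈ condTypical p δ w) :
    ∏ i, p (w i) (x i) ≤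
      (2 : ℝ) ^ (-(n : ℝ) * (∑ j, q j * shannonEntropy (p j) - 2 * δ * totalSurprisal p)) := by
  have hw' := (Finset.mem_filter.1 hw).2
  have hx' := (Finset.mem_filter.1 hx).2
  have hl2 : Real.log 2 ≠ 0 := (Real.log_pos one_lt_two).ne'
  have hpos : ∀ i, 0 < p (w i) (x i) := fun i => (hp0 _ _).lt_of_ne' fun h => by
    have := (hx' (w i) (x i)).2 h
    rw [countPair_eq, Finset.card_eq_zero] at this
    have hi : i ∈ Finset.univ.filter fun k => w k = w i ∧ x k = x i := by simp
    rw [this] at hi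
    simp at hi
  have hlog : Real.log (∏ i, p (w i) (x i)) =
      ∑ j, ∑ y, (countPair w x j y : ℝ) * Real.log (p j y) := by
    rw [Real.log_prod fun i _ => (hpos i).ne', sum_comp_pair w x fun j y => Real.log (p j y)]
  have hterm : ∀ j y, (countPair w x j y : ℝ) * Real.log (p j y) ≤
      -(n : ℝ) * (q j * Real.negMulLog (p j y) - 2 * δ * -Real.log (p j y)) := fun j y => by
    have h1 := (abs_le.1 (hx' j y).1).1
    have h2 := (abs_le.1 (hw' j).1).1
    have h3 : (countLetter w j : ℝ) ≤ n := by exact_mod_cast countLetter_le w j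
    have h4 : (countLetter w j : ℝ) * δ ≤ n * δ := mul_le_mul_of_nonneg_right h3 hδ
    have h5 : (n * q j - n * δ) * p j y ≤ countLetter w j * p j y :=
      mul_le_mul_of_nonneg_right (by linarith) (hp0 j y)
    have h6 : n * δ * p j y ≤ n * δ := mul_le_of_le_one_right (by positivity) (hp1 j y)
    -- One `n * δ` is lost from the typicality of `w`, the other from that of `x` given `w`; this is
    -- the `2 * δ` in the exponent.
    have h7 : n * q j * p j y - 2 * n * δ ≤ countPair w x j y := by nlinarith
    have h8 := mul_le_mul_of_nonneg_right h7
      (neg_nonneg.2 (Real.log_nonpos (hp0 j y) (hp1 j y)))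
    rw [Real.negMulLog]
    linarith
  rw [← Real.exp_log (Finset.prod_pos fun i _ => hpos i), Real.rpow_def_of_pos two_pos]
  refine Real.exp_le_exp.2 ?_
  rw [hlog]
  refine (Finset.sum_le_sum fun j _ => Finset.sum_le_sum fun y _ => hterm j y).trans_eq ?_
  simp only [shannonEntropy, totalSurprisal, ← Finset.mul_sum, Finset.sum_sub_distrib,
    mul_div_assoc', ← Finset.sum_div]
  field_simp

end Typical

/-! ### Doubly exponential decay against exponential growth. -/

section Asymptotics
open Filter Topology

/-- Half of `c * B ^ n` eventually dominates `n * log D`; the other half gives the decay. -/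
lemma tendsto_pow_mul_exp_neg_pow {D c B : ℝ} (hD : 0 < D) (hc : 0 < c) (hB : 1 < B) :
    Tendsto (fun n : ℕ => D ^ n * Real.exp (-(c * B ^ n))) atTop (𝓝 0) := by
  have hBn : Tendsto (fun n : ℕ => B ^ n) atTop atTop := tendsto_pow_atTop_atTop_of_one_lt hB
  have h1 : Tendsto (fun n : ℕ => Real.exp (-(c / 2 * B ^ n))) atTop (𝓝 0) :=
    Real.tendsto_exp_neg_atTop_nhds_zero.comp (hBn.const_mul_atTop (by positivity))
  have h2 : Tendsto (fun n : ℕ => Real.log D * ((n : ℝ) ^ 1 * (1 / B) ^ n)) atTop (𝓝 0) := by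
    have := (tendsto_pow_const_mul_const_pow_of_abs_lt_one 1 (r := 1 / B) (by
      rw [abs_of_pos (by positivity), div_lt_one (by positivity)]; exact hB)).const_mul (Real.log D)
    simpa using this
  refine squeeze_zero' (Eventually.of_forall fun n => by positivity) ?_ h1
  filter_upwards [h2.eventually (eventually_le_nhds (b := c / 2) (by positivity))] with n hn
  have hBp : 0 < B ^ n := by positivity
  have e : Real.log D * ((n : ℝ) ^ 1 * (1 / B) ^ n) = n * Real.log D / B ^ n := by
    rw [one_div, inv_pow, pow_one]; ring
  rw [e, div_le_iff₀ hBp] at hn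
  rw [← Real.exp_log hD, ← Real.exp_nat_mul, ← Real.exp_add]
  exact Real.exp_le_exp.2 (by linarith)

end Asymptotics

/-! ### One party: operator bounds and the sub-POVM probability. -/

section Party

variable {a u : Type*} [Fintype a] [DecidableEq a] [Fintype u] [DecidableEq u]
  {ρ : Matrix a a ℂ} {Λ : u → Matrix a a ℂ} {W₀ : Matrix a a ℂ} {p₀ : a → ℝ}
  {W : u → Matrix a a ℂ} {p : u → a → ℝ} {δ : ℝ} {n : ℕ}

/-- The state `Π_w ρ̂_w Π_w`. -/
noncomputable def condCutoff (ρ : Matrix a a ℂ) (Λ : u → Matrix a a ℂ) (W : u → Matrix a a ℂ)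
    (p : u → a → ℝ) (δ : ℝ) {n : ℕ} (w : Fin n → u) : Matrix (Fin n → a) (Fin n → a) ℂ :=
  condTypicalProjector W p δ w * tensorMat (fun i => canonicalState ρ Λ (w i)) *
    condTypicalProjector W p δ w

/-- The operator `√ρ⁻¹ Π_ρ`. -/
noncomputable def whitening (ρ W₀ : Matrix a a ℂ) (p₀ : a → ℝ) (δ : ℝ) (n : ℕ) :
    Matrix (Fin n → a) (Fin n → a) ℂ :=
  minvSqrt (tensorMat fun _ : Fin n => ρ) * typicalProjector W₀ p₀ δ n

lemma condCutoff_eq (h : ∀ j, IsSpectralDecomposition (canonicalState ρ Λ j) (W j) (p j))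
    (w : Fin n → u) : condCutoff ρ Λ W p δ w = tensorMat (fun i => W (w i)) *
      rdiag (fun x => indicatorVec (condTypical p δ w) x * ∏ i, p (w i) (x i)) *
        (tensorMat fun i => W (w i))ᴴ := by
  have hT := IsSpectralDecomposition.tensorMat fun i => h (w i)
  rw [condCutoff, condTypicalProjector, seqProjector_eq, hT.eq, conj_rdiag_mul hT.conj_mul,
    conj_rdiag_mul hT.conj_mul]
  congr 3
  ext x
  simp only [indicatorVec]
  split_ifs <;> simp

lemma condCutoff_posSemidef (hρ : IsDensity ρ) (hΛ : IsPOVM Λ)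
    (h : ∀ j, IsSpectralDecomposition (canonicalState ρ Λ j) (W j) (p j)) (w : Fin n → u) :
    (condCutoff ρ Λ W p δ w).PosSemidef := by
  rw [condCutoff_eq h]
  refine conj_rdiag_posSemidef _ fun x => ?_
  have : 0 ≤ ∏ i, p (w i) (x i) := Finset.prod_nonneg fun i _ =>
    (h _).posSemidef_iff.1 (canonicalState_posSemidef hρ hΛ _) _
  simp only [indicatorVec]
  split_ifs <;> simp [this]

lemma condCutoff_le_tensorMat (hρ : IsDensity ρ) (hΛ : IsPOVM Λ)
    (h : ∀ j, IsSpectralDecomposition (canonicalState ρ Λ j) (W j) (p j)) (w : Fin n → u) :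
    condCutoff ρ Λ W p δ w ≤ tensorMat fun i => canonicalState ρ Λ (w i) := by
  have hT := IsSpectralDecomposition.tensorMat fun i => h (w i)
  rw [condCutoff_eq h, hT.eq]
  refine conj_rdiag_mono _ fun x => ?_
  have : 0 ≤ ∏ i, p (w i) (x i) := Finset.prod_nonneg fun i _ =>
    (h _).posSemidef_iff.1 (canonicalState_posSemidef hρ hΛ _) _
  simp only [indicatorVec]
  split_ifs <;> simp [this]

lemma condCutoff_le_smul_one
    (h : ∀ j, IsSpectralDecomposition (canonicalState ρ Λ j) (W j) (p j)) {w : Fin n → u}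
    {κ : ℝ} (hκ0 : 0 ≤ κ) (hκ : ∀ x ∈ condTypical p δ w, ∏ i, p (w i) (x i) ≤ κ) :
    condCutoff ρ Λ W p δ w ≤ (κ : ℂ) • 1 := by
  have hT := IsSpectralDecomposition.tensorMat fun i => h (w i)
  rw [condCutoff_eq h, ← conj_rdiag_const hT.mul_conj κ]
  refine conj_rdiag_mono _ fun x => ?_
  simp only [indicatorVec]
  split_ifs with hx
  · rw [one_mul]; exact hκ x hx
  · rw [zero_mul]; exact hκ0

lemma whitening_eq (h₀ : IsSpectralDecomposition ρ W₀ p₀) :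
    whitening ρ W₀ p₀ δ n = tensorMat (fun _ => W₀) *
      rdiag (fun x => (√(seqProb p₀ x))⁻¹ * indicatorVec (weakTypical p₀ δ n) x) *
        (tensorMat fun _ => W₀)ᴴ := by
  have hT := IsSpectralDecomposition.tensorMat fun _ : Fin n => h₀
  rw [whitening, minvSqrt, hT.cfc_eq, typicalProjector, seqProjector_eq, conj_rdiag_mul hT.conj_mul]
  rfl

lemma whitening_conjTranspose (h₀ : IsSpectralDecomposition ρ W₀ p₀) :
    (whitening ρ W₀ p₀ δ n)ᴴ = whitening ρ W₀ p₀ δ n := by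
  rw [whitening_eq h₀]
  exact conj_rdiag_isHermitian _ _

lemma whitening_conjTranspose_eq_mul (h₀ : IsSpectralDecomposition ρ W₀ p₀) :
    (whitening ρ W₀ p₀ δ n)ᴴ =
      typicalProjector W₀ p₀ δ n * minvSqrt (tensorMat fun _ : Fin n => ρ) := by
  have hT := IsSpectralDecomposition.tensorMat fun _ : Fin n => h₀
  rw [whitening, conjTranspose_mul, typicalProjector, seqProjector_eq, minvSqrt, hT.cfc_eq,
    (conj_rdiag_isHermitian _ _).eq, (conj_rdiag_isHermitian _ _).eq]

/-- All factors are diagonal in the product eigenbasis of `ρ`, where each diagonal entry of the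
product is `0` or `1`. -/
lemma whitening_mul_tensorMat_le_one (hρ : IsDensity ρ)
    (h₀ : IsSpectralDecomposition ρ W₀ p₀) :
    whitening ρ W₀ p₀ δ n * (tensorMat fun _ : Fin n => ρ) * (whitening ρ W₀ p₀ δ n)ᴴ ≤ 1 := by
  have hT := IsSpectralDecomposition.tensorMat fun _ : Fin n => h₀
  have h1 := conj_rdiag_const hT.mul_conj 1
  rw [Complex.ofReal_one, one_smul] at h1
  rw [whitening_conjTranspose h₀, whitening_eq h₀, hT.eq, conj_rdiag_mul hT.conj_mul,
    conj_rdiag_mul hT.conj_mul, ← h1]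
  refine conj_rdiag_mono _ fun x => ?_
  have hx : 0 ≤ seqProb p₀ x := seqProb_nonneg (h₀.posSemidef_iff.1 hρ.1) x
  simp only [indicatorVec]
  split_ifs with hx'
  · change (√(seqProb p₀ x))⁻¹ * 1 * seqProb p₀ x * ((√(seqProb p₀ x))⁻¹ * 1) ≤ 1
    nth_rewrite 2 [← Real.mul_self_sqrt hx]
    by_cases h0 : √(seqProb p₀ x) = 0
    · simp [h0]
    · field_simp
      rfl
  · simp

lemma whitening_mul_self_le (h₀ : IsSpectralDecomposition ρ W₀ p₀) {κ : ℝ} (hκ : 0 ≤ κ) :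
    whitening ρ W₀ p₀ δ n * ((κ : ℂ) • 1) * (whitening ρ W₀ p₀ δ n)ᴴ ≤
      ((κ * 2 ^ ((n : ℝ) * (shannonEntropy p₀ + δ)) : ℝ) : ℂ) • 1 := by
  have hT := IsSpectralDecomposition.tensorMat fun _ : Fin n => h₀
  rw [← conj_rdiag_const hT.mul_conj, ← conj_rdiag_const hT.mul_conj, whitening_conjTranspose h₀,
    whitening_eq h₀, conj_rdiag_mul hT.conj_mul, conj_rdiag_mul hT.conj_mul]
  refine conj_rdiag_mono _ fun x => ?_
  simp only [indicatorVec]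
  split_ifs with hx'
  · have h1 := (Finset.mem_filter.1 hx').2.1
    rw [neg_mul, Real.rpow_neg two_pos.le] at h1
    have hpow : (0 : ℝ) < 2 ^ ((n : ℝ) * (shannonEntropy p₀ + δ)) := Real.rpow_pos_of_pos two_pos _
    have h2 : (seqProb p₀ x)⁻¹ ≤ 2 ^ ((n : ℝ) * (shannonEntropy p₀ + δ)) :=
      inv_le_of_inv_le₀ hpow h1
    have h3 : 0 < seqProb p₀ x := (inv_pos.2 hpow).trans_le h1
    calc _ = κ * (√(seqProb p₀ x) * √(seqProb p₀ x))⁻¹ := by rw [mul_inv]; ring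
      _ = κ * (seqProb p₀ x)⁻¹ := by rw [Real.mul_self_sqrt h3.le]
      _ ≤ _ := mul_le_mul_of_nonneg_left h2 hκ
  · simp only [mul_zero, zero_mul]
    positivity

open Classical in
lemma minvSqrt_mul_cutoffState_mul (h₀ : IsSpectralDecomposition ρ W₀ p₀) (w : Fin n → u) :
    minvSqrt (tensorMat fun _ : Fin n => ρ) * cutoffState ρ Λ W₀ p₀ W p δ w *
      minvSqrt (tensorMat fun _ : Fin n => ρ) =
    if w ∈ strongTypical (outcomeProb ρ Λ) δ n then
      whitening ρ W₀ p₀ δ n * condCutoff ρ Λ W p δ w * (whitening ρ W₀ p₀ δ n)ᴴ else 0 := by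
  rw [cutoffState]
  split_ifs
  · rw [whitening_conjTranspose_eq_mul h₀, whitening, condCutoff]
    simp only [Matrix.mul_assoc]
  · simp

/-- The normalized random operator `(1 - ε) √ρ⁻¹ ρ̃_w √ρ⁻¹`. -/
noncomputable def whitenedState (ρ : Matrix a a ℂ) (Λ : u → Matrix a a ℂ)
    (W₀ : Matrix a a ℂ) (p₀ : a → ℝ) (W : u → Matrix a a ℂ) (p : u → a → ℝ)
    (δ : ℝ) {n : ℕ} (w : Fin n → u) : Matrix (Fin n → a) (Fin n → a) ℂ :=
  (typicalMass (outcomeProb ρ Λ) δ n : ℂ) •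
    (minvSqrt (tensorMat fun _ : Fin n => ρ) * cutoffState ρ Λ W₀ p₀ W p δ w *
      minvSqrt (tensorMat fun _ : Fin n => ρ))

lemma typicalMass_nonneg (hρ : IsDensity ρ) (hΛ : IsPOVM Λ) (δ : ℝ) (n : ℕ) :
    0 ≤ typicalMass (outcomeProb ρ Λ) δ n :=
  Finset.sum_nonneg fun w _ => seqProb_nonneg (outcomeProb_nonneg hρ hΛ) w

lemma whitenedState_posSemidef (hρ : IsDensity ρ) (hΛ : IsPOVM Λ)
    (h₀ : IsSpectralDecomposition ρ W₀ p₀)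
    (h : ∀ j, IsSpectralDecomposition (canonicalState ρ Λ j) (W j) (p j)) (w : Fin n → u) :
    (whitenedState ρ Λ W₀ p₀ W p δ w).PosSemidef := by
  rw [whitenedState, minvSqrt_mul_cutoffState_mul h₀]
  refine PosSemidef.smul ?_ (by simpa using typicalMass_nonneg hρ hΛ δ n)
  split_ifs
  · exact (condCutoff_posSemidef hρ hΛ h w).mul_mul_conjTranspose_same _
  · exact PosSemidef.zero

lemma canonical_eigenvalue_nonneg (hρ : IsDensity ρ) (hΛ : IsPOVM Λ)
    (h : ∀ j, IsSpectralDecomposition (canonicalState ρ Λ j) (W j) (p j)) (j : u) (y : a) :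
    0 ≤ p j y :=
  (h j).posSemidef_iff.1 (canonicalState_posSemidef hρ hΛ j) y

lemma canonical_eigenvalue_le_one (hρ : IsDensity ρ) (hΛ : IsPOVM Λ)
    (h : ∀ j, IsSpectralDecomposition (canonicalState ρ Λ j) (W j) (p j)) (j : u) (y : a) :
    p j y ≤ 1 := by
  have h0 := canonical_eigenvalue_nonneg hρ hΛ h j
  have hle : p j y ≤ ∑ y, p j y := Finset.single_le_sum (fun y _ => h0 y) (Finset.mem_univ y)
  by_cases hj : outcomeProb ρ Λ j = 0
  · have ht := (h j).trace_eq
    rw [canonicalState, hj, Complex.ofReal_zero, _root_.inv_zero, zero_smul, trace_zero] at ht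
    have : ∑ y, p j y = 0 := by exact_mod_cast ht.symm
    linarith
  · rwa [canonical_eigenvalue_sum hρ hΛ (h j) hj] at hle

/-- This is the `K` of the Chernoff bound. The conditional cutoff contributes the slack `2 * δ *
totalSurprisal p`, the whitening contributes `δ`, and the typical mass is bounded by `1`. -/
lemma whitenedState_le (hρ : IsDensity ρ) (hΛ : IsPOVM Λ)
    (h₀ : IsSpectralDecomposition ρ W₀ p₀)
    (h : ∀ j, IsSpectralDecomposition (canonicalState ρ Λ j) (W j) (p j)) (hδ : 0 ≤ δ)
    (w : Fin n → u) :
    whitenedState ρ Λ W₀ p₀ W p δ w ≤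
      (((2 : ℝ) ^ ((n : ℝ) * (shannonEntropy p₀ -
        ∑ j, outcomeProb ρ Λ j * shannonEntropy (p j) + δ * (2 * totalSurprisal p + 1))) : ℝ) : ℂ)
        • 1 := by
  have hp0 := canonical_eigenvalue_nonneg hρ hΛ h
  have hp1 := canonical_eigenvalue_le_one hρ hΛ h
  have hm0 := typicalMass_nonneg hρ hΛ δ n
  have hm1 := typicalMass_le_one (outcomeProb_nonneg hρ hΛ) (sum_outcomeProb hρ hΛ) δ n
  set m := typicalMass (outcomeProb ρ Λ) δ n with hm
  set K : ℝ := (2 : ℝ) ^ ((n : ℝ) * (shannonEntropy p₀ -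
        ∑ j, outcomeProb ρ Λ j * shannonEntropy (p j) + δ * (2 * totalSurprisal p + 1))) with hK
  have hKpos : 0 < K := Real.rpow_pos_of_pos two_pos _
  rw [whitenedState, minvSqrt_mul_cutoffState_mul h₀, ← hm]
  have hle : (m : ℂ) • ((K : ℂ) • (1 : Matrix (Fin n → a) (Fin n → a) ℂ)) ≤ (K : ℂ) • 1 := by
    rw [smul_smul, ← Complex.ofReal_mul]
    exact real_smul_one_mono (mul_le_of_le_one_left hKpos.le hm1)
  refine le_trans (real_smul_mono ?_ hm0) hle
  split_ifs with hw
  · set κ : ℝ := (2 : ℝ) ^ (-(n : ℝ) * (∑ j, outcomeProb ρ Λ j * shannonEntropy (p j) -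
      2 * δ * totalSurprisal p)) with hκ
    have hκ0 : 0 ≤ κ := (Real.rpow_pos_of_pos two_pos _).le
    refine (conj_mono _ (condCutoff_le_smul_one h hκ0 fun x hx =>
      prod_le_of_mem_condTypical hp0 hp1 hδ hw hx)).trans ?_
    refine (whitening_mul_self_le h₀ hκ0).trans_eq ?_
    rw [hκ, ← Real.rpow_add two_pos, hK]
    congr 3
    ring
  · rw [le_iff, sub_zero]
    exact PosSemidef.one.smul (by simpa using hKpos.le)

lemma prunedProb_nonneg {q : u → ℝ} (hq : ∀ j, 0 ≤ q j) (δ : ℝ) (w : Fin n → u) :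
    0 ≤ prunedProb q δ n w := by
  rw [prunedProb]
  split_ifs
  · exact div_nonneg (seqProb_nonneg hq w) (Finset.sum_nonneg fun w _ => seqProb_nonneg hq w)
  · exact le_rfl

lemma sum_prunedProb {q : u → ℝ} (hm : typicalMass q δ n ≠ 0) :
    ∑ w, prunedProb q δ n w = 1 := by
  simp only [prunedProb, Finset.sum_ite_mem, Finset.univ_inter, ← Finset.sum_div]
  exact div_self hm

/-- The typical mass in `whitenedState` cancels the normalization of the pruned law, leaving the
product weights. Adding the nontypical terms and undoing the conditional cutoff only increase the
sum, which becomes the whitened tensor power of `ρ`. -/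
lemma sum_prunedProb_smul_whitenedState_le_one (hρ : IsDensity ρ) (hΛ : IsPOVM Λ)
    (h₀ : IsSpectralDecomposition ρ W₀ p₀)
    (h : ∀ j, IsSpectralDecomposition (canonicalState ρ Λ j) (W j) (p j))
    (hm : typicalMass (outcomeProb ρ Λ) δ n ≠ 0) :
    ∑ w, (prunedProb (outcomeProb ρ Λ) δ n w : ℂ) • whitenedState ρ Λ W₀ p₀ W p δ w ≤ 1 := by
  set q := outcomeProb ρ Λ with hq
  set L := whitening ρ W₀ p₀ δ n with hL
  have hq0 := outcomeProb_nonneg hρ hΛ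
  have hterm : ∀ w, (prunedProb q δ n w : ℂ) • whitenedState ρ Λ W₀ p₀ W p δ w ≤
      L * ((seqProb q w : ℂ) • tensorMat fun i => canonicalState ρ Λ (w i)) * Lᴴ := fun w => by
    have hA : L * ((seqProb q w : ℂ) • condCutoff ρ Λ W p δ w) * Lᴴ ≤
        L * ((seqProb q w : ℂ) • tensorMat fun i => canonicalState ρ Λ (w i)) * Lᴴ :=
      conj_mono L (real_smul_mono (condCutoff_le_tensorMat hρ hΛ h w) (seqProb_nonneg hq0 w))
    refine le_trans ?_ hA
    rw [whitenedState, minvSqrt_mul_cutoffState_mul h₀, prunedProb, ← hq]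
    split_ifs with hw
    · rw [smul_smul, ← Complex.ofReal_mul, div_mul_cancel₀ _ hm, Matrix.mul_smul, Matrix.smul_mul]
    · rw [smul_zero, smul_zero, le_iff, sub_zero]
      exact ((condCutoff_posSemidef hρ hΛ h w).smul
        (by simpa using seqProb_nonneg hq0 w)).mul_mul_conjTranspose_same L
  refine (Finset.sum_le_sum fun w _ => hterm w).trans ?_
  rw [← Matrix.sum_mul, ← Matrix.mul_sum, sum_seqProb_smul_tensorMat,
    sum_smul_canonicalState hρ hΛ]
  exact whitening_mul_tensorMat_le_one hρ h₀

/-- The weights count multiplicities, so summing over words is summing over codewords; this exposes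
the i.i.d. sum. -/
lemma sum_codeOperator (η : ℝ) {M : ℕ} (C : Fin M → Fin n → u) :
    ∑ w : {w // w ∈ strongTypical (outcomeProb ρ Λ) δ n},
      codeOperator ρ Λ W₀ p₀ W p δ η C w.1 =
    ((((1 + η) * M)⁻¹ : ℝ) : ℂ) • ∑ l, whitenedState ρ Λ W₀ p₀ W p δ (C l) := by
  have h1 : ∀ w, codeOperator ρ Λ W₀ p₀ W p δ η C w = ((((1 + η) * M)⁻¹ : ℝ) : ℂ) •
      ((Fintype.card {l // C l = w} : ℂ) • whitenedState ρ Λ W₀ p₀ W p δ w) := fun w => by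
    rw [codeOperator, whitenedState, smul_smul, smul_smul, codeWeight, mul_inv]
    congr 1
    push_cast
    ring
  have h2 : ∀ w, w ∉ strongTypical (outcomeProb ρ Λ) δ n →
      codeOperator ρ Λ W₀ p₀ W p δ η C w = 0 := fun w hw => by
    rw [codeOperator, cutoffState, if_neg hw]
    simp
  rw [Finset.sum_coe_sort (strongTypical (outcomeProb ρ Λ) δ n)
      (fun w => codeOperator ρ Λ W₀ p₀ W p δ η C w),
    Finset.sum_subset (Finset.subset_univ _) fun w _ hw => h2 w hw]
  simp only [h1, ← Finset.smul_sum]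
  congr 1
  rw [← Finset.sum_fiberwise Finset.univ C]
  refine Finset.sum_congr rfl fun w _ => ?_
  rw [Finset.sum_congr rfl fun l hl => by rw [(Finset.mem_filter.1 hl).2], Finset.sum_const,
    Fintype.card_subtype, Nat.cast_smul_eq_nsmul]

lemma isSubPOVM_codeOperator (hρ : IsDensity ρ) (hΛ : IsPOVM Λ)
    (h₀ : IsSpectralDecomposition ρ W₀ p₀)
    (h : ∀ j, IsSpectralDecomposition (canonicalState ρ Λ j) (W j) (p j)) {η : ℝ} (hη : 0 < η)
    {M : ℕ} (hM : 0 < M) {C : Fin M → Fin n → u}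
    (hC : ((((1 + η) * M : ℝ) : ℂ) • 1 -
      ∑ l, whitenedState ρ Λ W₀ p₀ W p δ (C l)).PosSemidef) :
    IsSubPOVM (fun w : {w // w ∈ strongTypical (outcomeProb ρ Λ) δ n} =>
      codeOperator ρ Λ W₀ p₀ W p δ η C w.1) := by
  have hM' : (0 : ℝ) < M := by exact_mod_cast hM
  refine ⟨fun w => ?_, ?_⟩
  · change (codeOperator ρ Λ W₀ p₀ W p δ η C w.1).PosSemidef
    rw [codeOperator, minvSqrt_mul_cutoffState_mul h₀, if_pos w.2]
    refine ((condCutoff_posSemidef hρ hΛ h w.1).mul_mul_conjTranspose_same _).smul ?_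
    have := typicalMass_nonneg hρ hΛ δ n
    have h1 : 0 ≤ codeWeight (outcomeProb ρ Λ) δ η C w.1 := by
      rw [codeWeight]; positivity
    simpa using h1
  · rw [sum_codeOperator]
    have hne : (1 + η) * (M : ℝ) ≠ 0 := by positivity
    have e : (1 : Matrix (Fin n → a) (Fin n → a) ℂ) =
        ((((1 + η) * M)⁻¹ : ℝ) : ℂ) • ((((1 + η) * M : ℝ) : ℂ) • 1) := by
      rw [smul_smul, ← Complex.ofReal_mul, inv_mul_cancel₀ hne, Complex.ofReal_one, one_smul]
    rw [e, ← smul_sub]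
    refine hC.smul ?_
    have h1 : 0 ≤ ((1 + η) * (M : ℝ))⁻¹ := by positivity
    exact Complex.zero_le_real.2 h1

lemma sum_prod_codebook {α : Type*} [Fintype α] {P : α → ℝ} (hP : ∑ x, P x = 1) (M : ℕ) :
    ∑ C : Fin M → α, ∏ l, P (C l) = 1 := by
  classical
  rw [sum_prod_seq fun _ => P]
  simp [hP]

/-- A single party: failure of the sub-POVM property has probability at most
`dim · exp (-η² M / (4 K))`. -/
lemma le_sum_subPOVMIndicator (hρ : IsDensity ρ) (hΛ : IsPOVM Λ)
    (h₀ : IsSpectralDecomposition ρ W₀ p₀)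
    (h : ∀ j, IsSpectralDecomposition (canonicalState ρ Λ j) (W j) (p j)) {η : ℝ}
    (hη : η ∈ Set.Ioo (0 : ℝ) 1) (hδ : 0 ≤ δ)
    (hm : typicalMass (outcomeProb ρ Λ) δ n ≠ 0) {M : ℕ} (hM : 0 < M) :
    1 - (Fintype.card a : ℝ) ^ n * Real.exp (-(η ^ 2 * M / (4 * (2 : ℝ) ^ ((n : ℝ) *
      (shannonEntropy p₀ - ∑ j, outcomeProb ρ Λ j * shannonEntropy (p j) +
        δ * (2 * totalSurprisal p + 1)))))) ≤
    ∑ C : Fin M → Fin n → u, (∏ l, prunedProb (outcomeProb ρ Λ) δ n (C l)) *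
      subPOVMIndicator ρ Λ W₀ p₀ W p δ η C := by
  classical
  have hP0 := fun w : Fin n → u => prunedProb_nonneg (outcomeProb_nonneg hρ hΛ) δ w
  have hP1 := sum_prunedProb hm
  have hch := matrix_chernoff hP0 hP1 (Real.rpow_pos_of_pos two_pos _)
    (fun w => whitenedState_posSemidef hρ hΛ h₀ h w)
    (fun w => le_iff.1 (whitenedState_le hρ hΛ h₀ h hδ w))
    (sum_prunedProb_smul_whitenedState_le_one hρ hΛ h₀ h hm) hη M
  have hcard : (Fintype.card (Fin n → a) : ℝ) = (Fintype.card a : ℝ) ^ n := by simp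
  rw [hcard] at hch
  refine (sub_le_sub (sum_prod_codebook hP1 M).ge hch).trans ?_
  rw [← Finset.sum_sub_distrib]
  refine Finset.sum_le_sum fun C _ => ?_
  rw [← mul_one_sub]
  refine mul_le_mul_of_nonneg_left ?_ (Finset.prod_nonneg fun l _ => hP0 _)
  rw [subPOVMIndicator]
  split_ifs with h1 h2 h2
  · simp
  · exact absurd (isSubPOVM_codeOperator hρ hΛ h₀ h hη.1 hM h1) h2
  · simp
  · simp

open Filter Topology in
/-- A single party: above the Holevo rate the sub-POVM property holds with probability tending
to one. -/
theorem eventually_sum_subPOVMIndicator (hρ : IsDensity ρ) (hΛ : IsPOVM Λ)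
    (h₀ : IsSpectralDecomposition ρ W₀ p₀)
    (h : ∀ j, IsSpectralDecomposition (canonicalState ρ Λ j) (W j) (p j)) {R η ε : ℝ}
    (hR : shannonEntropy p₀ - ∑ j, outcomeProb ρ Λ j * shannonEntropy (p j) < R)
    (hη : η ∈ Set.Ioo (0 : ℝ) 1) (hε : 0 < ε) :
    ∃ δ₀ ∈ Set.Ioo (0 : ℝ) 1, ∀ δ : ℝ, 0 < δ → δ < δ₀ → ∃ n₀ : ℕ, ∀ n : ℕ, n₀ ≤ n →
      1 - ε < ∑ C : Fin (codebookSize R n) → Fin n → u,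
        (∏ l, prunedProb (outcomeProb ρ Λ) δ n (C l)) *
          subPOVMIndicator ρ Λ W₀ p₀ W p δ η C := by
  set χ := shannonEntropy p₀ - ∑ j, outcomeProb ρ Λ j * shannonEntropy (p j) with hχ
  have hχ0 : 0 ≤ χ := sub_nonneg.2 (sum_mul_shannonEntropy_le hρ hΛ h₀ h)
  set L := 2 * totalSurprisal p + 1 with hL
  have hLpos : 0 < L := by
    have := totalSurprisal_nonneg (canonical_eigenvalue_nonneg hρ hΛ h)
      (canonical_eigenvalue_le_one hρ hΛ h)
    positivity
  have hgap : 0 < (R - χ) / L := div_pos (by linarith) hLpos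
  -- The second term keeps the rate `χ + δ * L` of `K` below `R`; `1 / 2` only ensures `δ₀ < 1`.
  refine ⟨min (1 / 2) ((R - χ) / L), ⟨lt_min (by norm_num) hgap,
    (min_le_left _ _).trans_lt (by norm_num)⟩, fun δ hδ hδ0 => ?_⟩
  have hδ1 : δ * L < R - χ := (lt_div_iff₀ hLpos).1 (hδ0.trans_le (min_le_right _ _))
  obtain ⟨x₀⟩ : Nonempty a := by
    by_contra hne
    rw [not_nonempty_iff] at hne
    have := hρ.2
    simp [trace] at this
  have hD : (0 : ℝ) < Fintype.card a := by exact_mod_cast Fintype.card_pos_iff.2 ⟨x₀⟩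
  set B : ℝ := (2 : ℝ) ^ (R - (χ + δ * L)) with hB
  have hB1 : 1 < B := Real.one_lt_rpow one_lt_two (by linarith)
  -- The `8` is the Chernoff `4` times the factor `2` lost by rounding the codebook size down.
  have hlim := tendsto_pow_mul_exp_neg_pow hD (c := η ^ 2 / 8) (by have := hη.1; positivity) hB1
  have hev : ∀ᶠ n : ℕ in atTop, (Fintype.card u : ℝ) ≤ n * δ :=
    (tendsto_natCast_atTop_atTop.atTop_mul_const hδ).eventually_ge_atTop _
  obtain ⟨n₀, hn₀⟩ := eventually_atTop.1 ((hlim.eventually (gt_mem_nhds hε)).and hev)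
  refine ⟨n₀, fun n hn => ?_⟩
  obtain ⟨h1, h2⟩ := hn₀ n hn
  have hq0 := outcomeProb_nonneg hρ hΛ
  have hm := (typicalMass_pos hq0 (strongTypical_nonempty hq0 (sum_outcomeProb hρ hΛ) h2)).ne'
  -- Nonnegativity of the Holevo quantity forces `R > 0`, so the codebook is nonempty and the floor
  -- loses at most half.
  have hpow1 : (1 : ℝ) ≤ 2 ^ ((n : ℝ) * R) :=
    Real.one_le_rpow one_le_two (mul_nonneg n.cast_nonneg (by linarith))
  have hM1 : 1 ≤ codebookSize R n := Nat.one_le_floor_iff _ |>.2 hpow1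
  have hM1' : (1 : ℝ) ≤ codebookSize R n := by exact_mod_cast hM1
  have hM2 : (2 : ℝ) ^ ((n : ℝ) * R) / 2 ≤ codebookSize R n := by
    have := Nat.lt_floor_add_one ((2 : ℝ) ^ ((n : ℝ) * R))
    rw [codebookSize] at hM1' ⊢
    linarith
  refine lt_of_lt_of_le ?_ (le_sum_subPOVMIndicator hρ hΛ h₀ h hη hδ.le hm hM1)
  refine sub_lt_sub_left (lt_of_le_of_lt ?_ h1) 1
  refine mul_le_mul_of_nonneg_left (Real.exp_le_exp.2 (neg_le_neg ?_)) (by positivity)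
  rw [← hχ, ← hL]
  set K : ℝ := (2 : ℝ) ^ ((n : ℝ) * (χ + δ * L)) with hK
  have hKpos : 0 < K := Real.rpow_pos_of_pos two_pos _
  have hBK : B ^ n * K = (2 : ℝ) ^ ((n : ℝ) * R) := by
    rw [hB, ← Real.rpow_natCast, ← Real.rpow_mul two_pos.le, hK, ← Real.rpow_add two_pos]
    congr 1
    ring
  rw [le_div_iff₀ (by positivity)]
  calc η ^ 2 / 8 * B ^ n * (4 * K) = η ^ 2 * (B ^ n * K / 2) := by ring
    _ ≤ _ := by rw [hBK]; exact mul_le_mul_of_nonneg_left hM2 (by positivity)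

lemma codebookExpectation_mul {α β : Type*} [Fintype α] [Fintype β] (P : α → ℝ) (Q : β → ℝ)
    {M₁ M₂ : ℕ} (f : (Fin M₁ → α) → ℝ) (g : (Fin M₂ → β) → ℝ) :
    codebookExpectation P Q (fun C₁ C₂ => f C₁ * g C₂) =
      (∑ C, (∏ l, P (C l)) * f C) * ∑ C, (∏ l, Q (C l)) * g C := by
  rw [codebookExpectation, Finset.sum_mul_sum]
  refine Finset.sum_congr rfl fun C₁ _ => Finset.sum_congr rfl fun C₂ _ => ?_
  ring

end Party

/-! ### Reduced states of the purification. -/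

section Marginals

variable {a b c r : Type*} [Fintype a] [DecidableEq a] [Fintype b] [DecidableEq b] [Fintype c]
  [DecidableEq c] [Fintype r] [DecidableEq r]

lemma trace_traceSnd (X : Matrix (a × b) (a × b) ℂ) : (traceSnd X).trace = X.trace := by
  simp [traceSnd, trace, Fintype.sum_prod_type]

lemma trace_traceFst (X : Matrix (a × b) (a × b) ℂ) : (traceFst X).trace = X.trace := by
  simp [traceFst, trace, Fintype.sum_prod_type_right]

lemma IsDensity.of_traceSnd_ketbra {ρ : Matrix a a ℂ} {φ : a × b → ℂ}
    (h : traceSnd (ketbra φ) = ρ) (ht : ρ.trace = 1) : IsDensity ρ := by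
  refine ⟨?_, ht⟩
  rw [← h, ← posSemidef_transpose_iff, ← conjTranspose_vecMatrix_mul]
  exact posSemidef_conjTranspose_mul_self _

lemma traceSnd_pureA {ρ : Matrix (a × b × c) (a × b × c) ℂ} {ψ : r × a × b × c → ℂ}
    (h : IsPurification ψ ρ) : traceSnd (pureA ψ) = marginalA ρ := by
  rw [marginalA, ← h]
  ext x x'
  simp only [traceSnd, traceFst, pureA, ketbra, of_apply, vecMulVec_apply, Pi.star_apply,
    Fintype.sum_prod_type]
  rw [Finset.sum_comm]
  refine Finset.sum_congr rfl fun y _ => ?_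
  rw [Finset.sum_comm]

lemma traceSnd_pureB {ρ : Matrix (a × b × c) (a × b × c) ℂ} {ψ : r × a × b × c → ℂ}
    (h : IsPurification ψ ρ) : traceSnd (pureB ψ) = marginalB ρ := by
  rw [marginalB, ← h]
  ext x x'
  simp only [traceSnd, traceFst, pureB, ketbra, of_apply, vecMulVec_apply, Pi.star_apply,
    Fintype.sum_prod_type]
  simp only [Finset.sum_comm (γ := r)]
  rw [Finset.sum_comm (γ := c)]

end Marginals

end PurityDistillation

/-! ### Combination of the two parties. -/

theorem mainTheorem7
    {a b c r S T U V : Type*}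
    [Fintype a] [DecidableEq a] [Fintype b] [DecidableEq b] [Fintype c] [DecidableEq c]
    [Fintype r] [DecidableEq r] [Fintype S] [DecidableEq S] [Fintype T] [DecidableEq T]
    [Fintype U] [DecidableEq U] [Fintype V] [DecidableEq V]
    -- the state and a purification of it
    (ρ : Matrix (a × b × c) (a × b × c) ℂ) (hρ : IsDensity ρ)
    (ψ : r × a × b × c → ℂ) (hψ : IsPurification ψ ρ)
    -- the two measurements and the functions of their outcomes
    (ΛA : S → Matrix a a ℂ) (hΛA : IsPOVM ΛA) (fS : S → U)
    (ΛB : T → Matrix b b ℂ) (hΛB : IsPOVM ΛB) (fT : T → V)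
    -- spectral decompositions of the reduced states and of the canonical ensembles
    (WA₀ : Matrix a a ℂ) (pA₀ : a → ℝ)
    (hA₀ : IsSpectralDecomposition (marginalA ρ) WA₀ pA₀)
    (WB₀ : Matrix b b ℂ) (pB₀ : b → ℝ)
    (hB₀ : IsSpectralDecomposition (marginalB ρ) WB₀ pB₀)
    (WA : U → Matrix a a ℂ) (pA : U → a → ℝ)
    (hA : ∀ u, IsSpectralDecomposition
      (canonicalState (marginalA ρ) (coarsePOVM fS ΛA) u) (WA u) (pA u))
    (WB : V → Matrix b b ℂ) (pB : V → b → ℝ)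
    (hB : ∀ v, IsSpectralDecomposition
      (canonicalState (marginalB ρ) (coarsePOVM fT ΛB) v) (WB v) (pB v))
    -- the rate conditions
    (R₁ R₂ : ℝ)
    (hR₁ : mutualInfo (relabel fS (postMeasurement ΛA (pureA ψ))) < R₁)
    (hR₂ : mutualInfo (relabel fT (postMeasurement ΛB (pureB ψ))) < R₂)
    (ε η : ℝ) (hε : ε ∈ Set.Ioo (0 : ℝ) 1) (hη : η ∈ Set.Ioo (0 : ℝ) 1) :
    ∃ δ₀ ∈ Set.Ioo (0 : ℝ) 1, ∀ δ : ℝ, 0 < δ → δ < δ₀ → ∃ n₀ : ℕ, ∀ n : ℕ, n₀ ≤ n →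
      1 - ε < codebookExpectation (M₁ := codebookSize R₁ n) (M₂ := codebookSize R₂ n)
        (prunedProb (outcomeProb (marginalA ρ) (coarsePOVM fS ΛA)) δ n)
        (prunedProb (outcomeProb (marginalB ρ) (coarsePOVM fT ΛB)) δ n)
        (fun C₁ C₂ =>
          subPOVMIndicator (marginalA ρ) (coarsePOVM fS ΛA) WA₀ pA₀ WA pA δ η C₁ *
            subPOVMIndicator (marginalB ρ) (coarsePOVM fT ΛB) WB₀ pB₀ WB pB δ η C₂) := by

  have htr : (marginalA ρ).trace = 1 := by rw [marginalA, trace_traceSnd, hρ.2]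
  have htr' : (marginalB ρ).trace = 1 := by rw [marginalB, trace_traceSnd, trace_traceFst, hρ.2]
  have hdA : IsDensity (marginalA ρ) := .of_traceSnd_ketbra (traceSnd_pureA hψ) htr
  have hdB : IsDensity (marginalB ρ) := .of_traceSnd_ketbra (traceSnd_pureB hψ) htr'
  rw [pureA, mutualInfo_eq _ (traceSnd_pureA hψ) hdA hΛA fS hA₀ hA] at hR₁
  rw [pureB, mutualInfo_eq _ (traceSnd_pureB hψ) hdB hΛB fT hB₀ hB] at hR₂
  obtain ⟨δ₁, hδ₁, h₁⟩ := eventually_sum_subPOVMIndicator hdA (hΛA.coarse fS) hA₀ hA hR₁ hη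
    (half_pos hε.1)
  obtain ⟨δ₂, hδ₂, h₂⟩ := eventually_sum_subPOVMIndicator hdB (hΛB.coarse fT) hB₀ hB hR₂ hη
    (half_pos hε.1)
  refine ⟨min δ₁ δ₂, ⟨lt_min hδ₁.1 hδ₂.1, (min_le_left _ _).trans_lt hδ₁.2⟩, fun δ hδ hlt => ?_⟩
  obtain ⟨n₁, h₁⟩ := h₁ δ hδ (hlt.trans_le (min_le_left _ _))
  obtain ⟨n₂, h₂⟩ := h₂ δ hδ (hlt.trans_le (min_le_right _ _))
  refine ⟨max n₁ n₂, fun n hn => ?_⟩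
  rw [codebookExpectation_mul]
  have k₁ := h₁ n ((le_max_left _ _).trans hn)
  have k₂ := h₂ n ((le_max_right _ _).trans hn)
  have hε0 : 0 < 1 - ε / 2 := by linarith [hε.2]
  -- Each party fails with probability below `ε / 2`, and `(1 - ε / 2)² = 1 - ε + ε² / 4`.
  have := mul_lt_mul'' k₁ k₂ hε0.le hε0.le
  nlinarith [sq_nonneg ε]
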